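/- Let $g>0$, $\mu>0$, and let $\bar\rho\in C^\infty(\mathbb R)\cap L^\infty(\mathbb R)$ be real-valued with $\bar\rho'\in C_0^\infty(\mathbb R)$, $\inf_{\mathbb R}\bar\rho>0$ and $\bar\rho'(x^0)>0$ for some $x^0\in\mathbb R$. Put $$M_{\mathrm c}:=\Big(\sup_{0\not\equiv\psi\in H^1(\mathbb R)}\frac{\int_{\mathbb R} g\bar\rho'\psi^2\,dx}{\int_{\mathbb R}|\psi'|^2\,dx}\Big)^{1/2}\in(0,\infty].$$ Let the constant magnetic field $\bar{\mathbf M}$ be either $M\mathbf e_1$ with $M\neq0$ (horizontal case) or $M\mathbf e_3$ with $0<|M|<M_{\mathrm c}$ (vertical case). For $\xi=(\xi_1,\xi_2)\in\mathbb R^2$ with $0<|M\xi_1|/|\xi|<M_{\mathrm c}$ (horizontal case) put $$S(\xi):=\Big(\sup_{0\not\equiv\psi\in H^1(\mathbb R)}\frac{\frac{g|\xi|^2}{(M\xi_1)^2}\int\bar\rho'\psi^2\,dx-\int|\psi'|^2\,dx}{\int\psi^2\,dx}\Big)^{1/2},$$ and in the vertical case put $$|\xi|^M_{\mathrm{vc}}:=\Big(\inf\Big\{\frac{M^2\int|\psi''|^2\,dx}{\int(g\bar\rho'\psi^2-M^2|\psi'|^2)\,dx}\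 :\ \psi\in H^2(\mathbb R),\ \int(g\bar\rho'\psi^2-M^2|\psi'|^2)\,dx>0\Big\}\Big)^{1/2}.$$ The solvable domain is $$\mathbb A^{\mathrm g}:=\begin{cases}\big(\{\xi: 0<|M\xi_1|/|\xi|<M_{\mathrm c},\ |\xi|<S(\xi)\}\cup\{\xi:\xi_1=0\}\big)\setminus\{\mathbf 0\}&\text{(horizontal case)},\\ \{\xi: |\xi|>|\xi|^M_{\mathrm{vc}}\}&\text{(vertical case)}.\end{cases}$$ For $\xi\ne \mathbf 0$ let $\mathcal A:=\{\psi\in H^2(\mathbb R): \int_{\mathbb R}\bar\rho(|\xi|^2\psi^2+|\psi'|^2)\,dx=1\}$ and, for $s>0$, $E(\psi,s):=|\xi|^2E_0(\psi)+s\mu\int_{\mathbb R}\big(4|\xi|^2|\psi'|^2+(|\xi|^2\psi+\psi'')^2\big)dx$, where $E_0(\psi)=\int_{\mathbb R} M^2\xi_1^2\big(\psi^2+|\psi'|^2/|\xi|^2\big)-g\bar\rho'\psi^2\,dx$ in the horizontal case and $E_0(\psi)=\int_{\mathbb R} M^2\big(|\psi'|^2+|\psi''|^2/|\xi|^2\big)-g\bar\rho'\psi^2\,dx$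 in the vertical case. Theorem. For each $\xi\in\mathbb A^{\mathrm g}$ there are a number $\lambda=\lambda(\xi)>0$ with $-\lambda^2=\inf_{\psi\in\mathcal A}E(\psi,\lambda)$ and real-valued smooth functions $\varphi,\theta,\psi,\pi\in H^\infty(\mathbb R)=\bigcap_{k\ge0}H^k(\mathbb R)$ with $\psi\in\mathcal A$ that solve on $\mathbb R$ the system $$\begin{cases}\lambda^2\bar\rho\varphi-\lambda\xi_1\pi+\lambda\mu(|\xi|^2\varphi-\varphi'')=M^2B_1,\\ \lambda^2\bar\rho\theta-\lambda\xi_2\pi+\lambda\mu(|\xi|^2\theta-\theta'')=M^2B_2,\\ \lambda^2\bar\rho\psi+\lambda\pi'+\lambda\mu(|\xi|^2\psi-\psi'')-g\bar\rho'\psi=M^2B_3,\\ \xi_1\varphi+\xi_2\theta+\psi'=0,\end{cases}$$ with $\varphi(\pm\infty)=\theta(\pm\infty)=\psi(\pm\infty)=0$, where $(B_1,B_2,B_3)=\big(0,\ \xi_1\xi_2\varphi-\xi_1^2\theta,\ -(\xi_1^2\psi+\xi_1\varphi')\big)$ in the horizontal case and $(B_1,B_2,B_3)=\big(\varphi''+\xi_1\psi',\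 \theta''+\xi_2\psi',\ 0\big)$ in the vertical case. -/

import Mathlib

open MeasureTheory Filter Topology
open scoped ContDiff ENNReal

noncomputable section

namespace RTMHD

/-- `f'` is a weak derivative of `f` on the real line. -/
def IsWeakDeriv (f f' : ℝ → ℝ) : Prop :=
  LocallyIntegrable f volume ∧ LocallyIntegrable f' volume ∧
    ∀ η : ℝ → ℝ, ContDiff ℝ ∞ η → HasCompactSupport η →
      ∫ x, f x * deriv η x = -∫ x, f' x * η x

open Classical in
/-- A weak derivative of `f`, unique up to null sets (and `0` if `f` has none). -/
def weakDeriv (f : ℝ → ℝ) : ℝ → ℝ :=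
  if h : ∃ f', IsWeakDeriv f f' then h.choose else 0

/-- `f ∈ H^k(ℝ)`: `f` and its weak derivatives up to order `k` are square integrable. -/
def MemH : ℕ → (ℝ → ℝ) → Prop
  | 0, f => MemLp f 2 volume
  | k + 1, f => MemLp f 2 volume ∧ ∃ f', IsWeakDeriv f f' ∧ MemH k f'

/-- `f ∈ H^∞(ℝ) = ⋂ₖ H^k(ℝ)`. -/
def MemHInfty (f : ℝ → ℝ) : Prop := ∀ k : ℕ, MemH k f

/-- Smooth bounded Rayleigh–Taylor density profile `ρ̄` with `ρ̄' ∈ C₀^∞(ℝ)`, `inf ρ̄ > 0` and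
`ρ̄' > 0` at some point. -/
structure IsRTProfile (ρ : ℝ → ℝ) : Prop where
  smooth : ContDiff ℝ ∞ ρ
  bounded : MemLp ρ ⊤ volume
  compact_deriv : HasCompactSupport (deriv ρ)
  inf_pos : ∃ c : ℝ, 0 < c ∧ ∀ x, c ≤ ρ x
  exists_deriv_pos : ∃ x₀, 0 < deriv ρ x₀

/-- Direction of the constant magnetic field: `M e₁` (horizontal) or `M e₃` (vertical). -/
inductive FieldDir
  | horizontal
  | vertical

/-- The horizontal frequency plane `ℝ²` with its Euclidean norm; `ξ 0` and `ξ 1` are the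
components `ξ₁` and `ξ₂`. -/
abbrev Freq := EuclideanSpace ℝ (Fin 2)

/-- The critical number `M_c ∈ [0, ∞]`, the square root of the supremum of
`∫ g ρ̄' ψ² / ∫ |ψ'|²` over nonzero `ψ ∈ H¹(ℝ)`. Negative quotients, replaced by `0` here, do not
affect the supremum, which is positive because `ρ̄'` is positive somewhere. -/
def criticalNumber (g : ℝ) (ρ : ℝ → ℝ) : ℝ≥0∞ :=
  (⨆ (ψ : ℝ → ℝ) (_ : MemH 1 ψ ∧ ¬ ψ =ᵐ[volume] 0),
    ENNReal.ofReal ((∫ x, g * deriv ρ x * ψ x ^ 2) / ∫ x, weakDeriv ψ x ^ 2)) ^ (1 / 2 : ℝ)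

/-- The critical frequency function `S(ξ)` (horizontal field), used only where
`0 < |M ξ₁| / |ξ| < M_c`. -/
def criticalFreqFun (g M : ℝ) (ρ : ℝ → ℝ) (ξ : Freq) : ℝ :=
  Real.sqrt (sSup {q : ℝ | ∃ ψ : ℝ → ℝ, MemH 1 ψ ∧ ¬ ψ =ᵐ[volume] 0 ∧
    q = (g * ‖ξ‖ ^ 2 * (∫ x, deriv ρ x * ψ x ^ 2) / (M * ξ 0) ^ 2
          - ∫ x, weakDeriv ψ x ^ 2) / ∫ x, ψ x ^ 2})

/-- The critical frequency constant `|ξ|_vc^M` (vertical field), used only for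
`0 < |M| < M_c`. -/
def criticalFreqConst (g M : ℝ) (ρ : ℝ → ℝ) : ℝ :=
  Real.sqrt (sInf {q : ℝ | ∃ ψ : ℝ → ℝ, MemH 2 ψ ∧
    0 < (∫ x, (g * deriv ρ x * ψ x ^ 2 - M ^ 2 * weakDeriv ψ x ^ 2)) ∧
    q = (M ^ 2 * ∫ x, weakDeriv (weakDeriv ψ) x ^ 2) /
          ∫ x, (g * deriv ρ x * ψ x ^ 2 - M ^ 2 * weakDeriv ψ x ^ 2)})

/-- The admissible field strengths: `M ≠ 0` for `M e₁`, and `0 < |M| < M_c` for `M e₃`. -/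
def AdmissibleField (g : ℝ) (ρ : ℝ → ℝ) (M : ℝ) : FieldDir → Prop
  | .horizontal => M ≠ 0
  | .vertical => 0 < |M| ∧ ENNReal.ofReal |M| < criticalNumber g ρ

/-- The solvable domain `𝔸^g ⊆ ℝ²`. -/
def solvableDomain (g M : ℝ) (ρ : ℝ → ℝ) : FieldDir → Set Freq
  | .horizontal =>
      ({ξ | 0 < |ξ 0 * M| / ‖ξ‖ ∧ ENNReal.ofReal (|ξ 0 * M| / ‖ξ‖) < criticalNumber g ρ ∧
          ‖ξ‖ < criticalFreqFun g M ρ ξ} ∪ {ξ | ξ 0 = 0}) \ {0}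
  | .vertical => {ξ | criticalFreqConst g M ρ < ‖ξ‖}

/-- The functional `J(ψ) = ∫ ρ̄ (|ξ|² ψ² + |ψ'|²)`. -/
def J (ρ : ℝ → ℝ) (ξ : Freq) (ψ : ℝ → ℝ) : ℝ :=
  ∫ x, ρ x * (‖ξ‖ ^ 2 * ψ x ^ 2 + weakDeriv ψ x ^ 2)

/-- The admissible set `𝒜 = {ψ ∈ H²(ℝ) | J(ψ) = 1}`. -/
def admissibleSet (ρ : ℝ → ℝ) (ξ : Freq) : Set (ℝ → ℝ) :=
  {ψ | MemH 2 ψ ∧ J ρ ξ ψ = 1}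

/-- The functional `E₀`. -/
def E₀ (g M : ℝ) (ρ : ℝ → ℝ) (ξ : Freq) : FieldDir → (ℝ → ℝ) → ℝ
  | .horizontal, ψ =>
      ∫ x, (M ^ 2 * ξ 0 ^ 2 * (ψ x ^ 2 + weakDeriv ψ x ^ 2 / ‖ξ‖ ^ 2)
        - g * deriv ρ x * ψ x ^ 2)
  | .vertical, ψ =>
      ∫ x, (M ^ 2 * (weakDeriv ψ x ^ 2 + weakDeriv (weakDeriv ψ) x ^ 2 / ‖ξ‖ ^ 2)
        - g * deriv ρ x * ψ x ^ 2)

/-- The functional `E₁`. -/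
def E₁ (μ : ℝ) (ξ : Freq) (ψ : ℝ → ℝ) : ℝ :=
  μ * ∫ x, (4 * ‖ξ‖ ^ 2 * weakDeriv ψ x ^ 2 +
    (‖ξ‖ ^ 2 * ψ x + weakDeriv (weakDeriv ψ) x) ^ 2)

/-- The energy `E(ψ, s) = |ξ|² E₀(ψ) + s E₁(ψ)`. -/
def E (g μ M : ℝ) (ρ : ℝ → ℝ) (dir : FieldDir) (ξ : Freq) (s : ℝ) (ψ : ℝ → ℝ) : ℝ :=
  ‖ξ‖ ^ 2 * E₀ g M ρ ξ dir ψ + s * E₁ μ ξ ψ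

/-- `lam` is the growth rate `λ(ξ)`: the positive number with
`-λ² = inf_{ψ ∈ 𝒜} E(ψ, λ)`. -/
def IsGrowthRate (g μ M : ℝ) (ρ : ℝ → ℝ) (dir : FieldDir) (ξ : Freq) (lam : ℝ) : Prop :=
  0 < lam ∧ IsGLB (E g μ M ρ dir ξ lam '' admissibleSet ρ ξ) (-lam ^ 2)

/-- The magnetic term `B₁`. -/
def B₁ (ξ : Freq) (φ ψ : ℝ → ℝ) : FieldDir → ℝ → ℝ
  | .horizontal, _ => 0
  | .vertical, x => deriv (deriv φ) x + ξ 0 * deriv ψ x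

/-- The magnetic term `B₂`. -/
def B₂ (ξ : Freq) (φ θ ψ : ℝ → ℝ) : FieldDir → ℝ → ℝ
  | .horizontal, x => ξ 0 * ξ 1 * φ x - ξ 0 ^ 2 * θ x
  | .vertical, x => deriv (deriv θ) x + ξ 1 * deriv ψ x

/-- The magnetic term `B₃`. -/
def B₃ (ξ : Freq) (φ ψ : ℝ → ℝ) : FieldDir → ℝ → ℝ
  | .horizontal, x => -(ξ 0 ^ 2 * ψ x + ξ 0 * deriv φ x)
  | .vertical, _ => 0

/-- `(φ, θ, ψ, p)` is a smooth solution, with growth parameter `lam`, of the normal-mode system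
on `ℝ`, with `φ, θ, ψ` vanishing at `±∞`; `p` is the pressure amplitude `π`. -/
structure IsNormalMode (g μ M : ℝ) (ρ : ℝ → ℝ) (dir : FieldDir) (ξ : Freq) (lam : ℝ)
    (φ θ ψ p : ℝ → ℝ) : Prop where
  smooth_φ : ContDiff ℝ ∞ φ
  smooth_θ : ContDiff ℝ ∞ θ
  smooth_ψ : ContDiff ℝ ∞ ψ
  smooth_p : ContDiff ℝ ∞ p
  eq₁ : ∀ x, lam ^ 2 * ρ x * φ x - lam * ξ 0 * p x
      + lam * μ * (‖ξ‖ ^ 2 * φ x - deriv (deriv φ) x) = M ^ 2 * B₁ ξ φ ψ dir x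
  eq₂ : ∀ x, lam ^ 2 * ρ x * θ x - lam * ξ 1 * p x
      + lam * μ * (‖ξ‖ ^ 2 * θ x - deriv (deriv θ) x) = M ^ 2 * B₂ ξ φ θ ψ dir x
  eq₃ : ∀ x, lam ^ 2 * ρ x * ψ x + lam * deriv p x
      + lam * μ * (‖ξ‖ ^ 2 * ψ x - deriv (deriv ψ) x) - g * deriv ρ x * ψ x
        = M ^ 2 * B₃ ξ φ ψ dir x
  eq₄ : ∀ x, ξ 0 * φ x + ξ 1 * θ x + deriv ψ x = 0
  φ_bot : Tendsto φ atBot (𝓝 0)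
  θ_bot : Tendsto θ atBot (𝓝 0)
  ψ_bot : Tendsto ψ atBot (𝓝 0)
  φ_top : Tendsto φ atTop (𝓝 0)
  θ_top : Tendsto θ atTop (𝓝 0)
  ψ_top : Tendsto ψ atTop (𝓝 0)

end RTMHD

end

/-! Since `J = 1` on `𝒜`, the condition `-λ² = inf E(·, λ)` says that the quadratic pencil
`s² J + s E₁ + |ξ|² E₀` on `H²(ℝ)` is nonnegative at `s = λ`, with infimum `0` over `𝒜`. The pencil
is nonnegative for large `s`, and negative somewhere for small `s` because in the solvable domain
gravity beats the magnetic tension, that is, `E₀` takes a negative value; `λ` is the least parameter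
from which on it is nonnegative. The only indefinite term `∫ ρ̄' ψ²` is compact since `ρ̄'` has
compact support, so the infimum is attained, and the minimizer `ψ` solves a fourth-order
Euler–Lagrange equation, which makes it smooth with all derivatives in `L²`. The horizontal
velocities `φ = -ξ₁ ψ' / |ξ|²` and `θ = -ξ₂ ψ' / |ξ|²` solve the divergence equation, the horizontal
momentum equations then define the pressure, and the vertical one is the Euler–Lagrange equation. -/

noncomputable section

namespace RTMHD

open scoped RealInnerProductSpace

/-! ### Weak derivatives on the line -/

/-- Smooth compactly supported test functions. -/
structure IsTest (η : ℝ → ℝ) : Prop where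
  smooth : ContDiff ℝ ∞ η
  compact : HasCompactSupport η

namespace IsTest

variable {η ζ f : ℝ → ℝ}

protected theorem deriv (hη : IsTest η) : IsTest (deriv η) :=
  ⟨(contDiff_infty_iff_deriv.1 hη.smooth).2, hη.compact.deriv⟩

protected theorem continuous (hη : IsTest η) : Continuous η := hη.smooth.continuous

theorem hasDerivAt (hη : IsTest η) (x : ℝ) : HasDerivAt η (deriv η x) x :=
  (hη.smooth.differentiable (by simp) x).hasDerivAt

theorem mul_left {p : ℝ → ℝ} (hp : ContDiff ℝ ∞ p) (hη : IsTest η) :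
    IsTest (fun x => p x * η x) :=
  ⟨hp.mul hη.smooth, hη.compact.mul_left⟩

theorem sub_const_mul (hη : IsTest η) (hζ : IsTest ζ) (c : ℝ) :
    IsTest (fun x => η x - c * ζ x) :=
  ⟨hη.smooth.sub (contDiff_const.mul hζ.smooth),
    hη.compact.sub (hζ.compact.mul_left (f := fun _ => c))⟩

theorem memLp (hη : IsTest η) (p : ℝ≥0∞) : MemLp η p volume :=
  hη.continuous.memLp_of_hasCompactSupport hη.compact

theorem integrable (hη : IsTest η) : Integrable η := memLp_one_iff_integrable.1 (hη.memLp 1)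

theorem integrable_mul (hη : IsTest η) (hf : LocallyIntegrable f) :
    Integrable (fun x => f x * η x) := by
  simpa only [smul_eq_mul, mul_comm] using
    hf.integrable_smul_left_of_hasCompactSupport hη.continuous hη.compact

theorem integral_mul_add_const_mul (hf : LocallyIntegrable f) (hη : IsTest η) (hζ : IsTest ζ)
    (c : ℝ) : ∫ x, f x * (η x + c * ζ x) = (∫ x, f x * η x) + c * ∫ x, f x * ζ x := by
  simp only [mul_add, mul_left_comm _ c]
  rw [integral_add (hη.integrable_mul hf) ((hζ.integrable_mul hf).const_mul c), integral_const_mul]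

theorem exists_tsupport_subset (hη : IsTest η) : ∃ R : ℝ, 0 < R ∧ tsupport η ⊆ Set.Ioo (-R) R := by
  obtain ⟨R, hR, h⟩ := hη.compact.isCompact.isBounded.subset_ball_lt 0 0
  exact ⟨R, hR, by simpa only [Real.ball_eq_Ioo, zero_sub, zero_add] using h⟩

theorem exists_deriv_eq (hη : IsTest η) (h0 : ∫ x, η x = 0) : ∃ ζ, IsTest ζ ∧ deriv ζ = η := by
  obtain ⟨R, -, hR⟩ := hη.exists_tsupport_subset
  have hsupp {x : ℝ} (hx : η x ≠ 0) : x ∈ Set.Ioo (-R) R := hR (subset_tsupport η hx)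
  let ζ : ℝ → ℝ := fun x => ∫ t in (-R)..x, η t
  have hderiv (x : ℝ) : HasDerivAt ζ (η x) x := hη.continuous.integral_hasStrictDerivAt _ x
    |>.hasDerivAt
  have hζ : deriv ζ = η := funext fun x => (hderiv x).deriv
  have hzero {x : ℝ} (hx : x ∉ Set.Icc (-R) R) : ζ x = 0 := by
    rcases lt_or_ge x (-R) with h | h
    · refine intervalIntegral.integral_zero_ae (ae_of_all _ fun t ht => ?_)
      by_contra hne
      rw [Set.uIoc_of_ge h.le] at ht
      linarith [(hsupp hne).1, ht.2]
    · have hxR : R < x := not_le.1 fun h' => hx ⟨h, h'⟩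
      change ∫ t in (-R)..x, η t = 0
      rw [intervalIntegral.integral_eq_integral_of_support_subset, h0]
      exact fun t ht => ⟨(hsupp ht).1, (hsupp ht).2.le.trans hxR.le⟩
  exact ⟨ζ, ⟨contDiff_infty_iff_deriv.2 ⟨fun x => (hderiv x).differentiableAt, hζ ▸ hη.smooth⟩,
    HasCompactSupport.intro isCompact_Icc fun _ => hzero⟩, hζ⟩

end IsTest

theorem exists_isTest_integral_eq_one : ∃ θ : ℝ → ℝ, IsTest θ ∧ ∫ x, θ x = 1 := by
  let f : ContDiffBump (0 : ℝ) := ⟨1, 2, one_pos, one_lt_two⟩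
  exact ⟨f.normed volume, ⟨f.contDiff_normed, f.hasCompactSupport_normed⟩, f.integral_normed⟩

theorem IsTest.exists_eq_deriv_add {ζ θ : ℝ → ℝ} (hζ : IsTest ζ) (hθ : IsTest θ)
    (hθ1 : ∫ x, θ x = 1) : ∃ η, IsTest η ∧ ζ = fun x => deriv η x + (∫ t, ζ t) * θ x := by
  obtain ⟨η, hη, h⟩ := (hζ.sub_const_mul hθ (∫ t, ζ t)).exists_deriv_eq (by
    rw [integral_sub hζ.integrable (hθ.integrable.const_mul _), integral_const_mul, hθ1, mul_one,
      sub_self])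
  exact ⟨η, hη, funext fun x => by rw [h, sub_add_cancel]⟩

/-- The du Bois-Reymond lemma. -/
theorem exists_ae_eq_const_of_integral_mul_deriv_eq_zero {f : ℝ → ℝ} (hf : LocallyIntegrable f)
    (h : ∀ η, IsTest η → ∫ x, f x * deriv η x = 0) : ∃ c : ℝ, f =ᵐ[volume] fun _ => c := by
  obtain ⟨θ, hθ, hθ1⟩ := exists_isTest_integral_eq_one
  refine ⟨∫ x, f x * θ x, ae_eq_of_integral_contDiff_smul_eq hf (locallyIntegrable_const _)
    fun ζ hζ hζ' => ?_⟩
  obtain ⟨η, hη, hηζ⟩ := IsTest.exists_eq_deriv_add ⟨hζ, hζ'⟩ hθ hθ1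
  simp only [smul_eq_mul, integral_mul_const, mul_comm (ζ _) (f _)]
  conv_lhs => rw [hηζ]
  rw [IsTest.integral_mul_add_const_mul hf hη.deriv hθ, h η hη, zero_add]

theorem intervalIntegrable_of_locallyIntegrable {f : ℝ → ℝ} (hf : LocallyIntegrable f) (a b : ℝ) :
    IntervalIntegrable f volume a b :=
  (hf.integrableOn_isCompact isCompact_uIcc).intervalIntegrable

theorem integral_primitive_mul_deriv {f η : ℝ → ℝ} (hf : LocallyIntegrable f) (hη : IsTest η) :
    ∫ x, (∫ t in (0 : ℝ)..x, f t) * deriv η x = -∫ x, f x * η x := by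
  obtain ⟨R, hR0, hR⟩ := hη.exists_tsupport_subset
  have hzero {x : ℝ} (hx : x ∉ Set.Ioo (-R) R) : η x = 0 :=
    image_eq_zero_of_notMem_tsupport fun h => hx (hR h)
  have hac : AbsolutelyContinuousOnInterval (fun x => ∫ t in (0 : ℝ)..x, f t) (-R) R :=
    (intervalIntegrable_of_locallyIntegrable hf (-R) R)
      |>.absolutelyContinuousOnInterval_intervalIntegral
        (by rw [Set.uIcc_of_le (by linarith)]; constructor <;> linarith)
  have hacη : AbsolutelyContinuousOnInterval η (-R) R :=
    (hη.smooth.of_le (mod_cast le_top) : ContDiff ℝ 1 η).contDiffOn.absolutelyContinuousOnInterval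
  have hparts := hac.integral_mul_deriv_eq_deriv_mul hacη
  rw [hzero (x := R) (by simp), hzero (x := -R) (by simp), mul_zero, mul_zero, sub_zero, zero_sub,
    intervalIntegral.integral_eq_integral_of_support_subset] at hparts
  · rw [hparts, neg_inj,
      ← intervalIntegral.integral_eq_integral_of_support_subset (a := -R) (b := R)]
    · refine intervalIntegral.integral_congr_ae ?_
      filter_upwards [LocallyIntegrable.ae_hasDerivAt_integral hf] with x hx _
      rw [(hx 0).deriv]
    · exact fun x hx => Set.Ioo_subset_Ioc_self
        (hR (subset_tsupport η (right_ne_zero_of_mul hx)))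
  · exact fun x hx => Set.Ioo_subset_Ioc_self
      (hR (tsupport_deriv_subset (subset_tsupport _ (right_ne_zero_of_mul hx))))

namespace IsWeakDeriv

variable {f f' g g' : ℝ → ℝ}

theorem integral_mul_deriv (h : IsWeakDeriv f f') {η : ℝ → ℝ} (hη : IsTest η) :
    ∫ x, f x * deriv η x = -∫ x, f' x * η x := h.2.2 η hη.smooth hη.compact

theorem congr (h : IsWeakDeriv f f') (hf : f =ᵐ[volume] g) (hf' : f' =ᵐ[volume] g') :
    IsWeakDeriv g g' := by
  refine ⟨h.1.congr hf, h.2.1.congr hf', fun ζ hζ hζ' => ?_⟩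
  calc ∫ x, g x * deriv ζ x = ∫ x, f x * deriv ζ x :=
        integral_congr_ae (hf.symm.mul EventuallyEq.rfl)
    _ = -∫ x, f' x * ζ x := h.2.2 ζ hζ hζ'
    _ = -∫ x, g' x * ζ x := congrArg Neg.neg (integral_congr_ae (hf'.mul EventuallyEq.rfl))

theorem unique (h : IsWeakDeriv f f') (h' : IsWeakDeriv f g') : f' =ᵐ[volume] g' := by
  refine ae_eq_of_integral_contDiff_smul_eq h.2.1 h'.2.1 fun ζ hζ hζ' => ?_
  simp only [smul_eq_mul, mul_comm (ζ _)]
  exact neg_injective ((h.2.2 ζ hζ hζ').symm.trans (h'.2.2 ζ hζ hζ'))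

theorem weakDeriv_ae_eq (h : IsWeakDeriv f f') : weakDeriv f =ᵐ[volume] f' := by
  have hex : ∃ f', IsWeakDeriv f f' := ⟨f', h⟩
  rw [weakDeriv, dif_pos hex]
  exact hex.choose_spec.unique h

theorem add (h : IsWeakDeriv f f') (h' : IsWeakDeriv g g') :
    IsWeakDeriv (fun x => f x + g x) (fun x => f' x + g' x) := by
  refine ⟨h.1.add h'.1, h.2.1.add h'.2.1, fun ζ hζ hζ' => ?_⟩
  have ht : IsTest ζ := ⟨hζ, hζ'⟩
  simp only [add_mul]
  rw [integral_add (ht.deriv.integrable_mul h.1) (ht.deriv.integrable_mul h'.1),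
    integral_add (ht.integrable_mul h.2.1) (ht.integrable_mul h'.2.1),
    h.integral_mul_deriv ht, h'.integral_mul_deriv ht, neg_add]

theorem smooth_mul {p : ℝ → ℝ} (hp : ContDiff ℝ ∞ p) (h : IsWeakDeriv f f') :
    IsWeakDeriv (fun x => p x * f x) (fun x => deriv p x * f x + p x * f' x) := by
  have hp' : ContDiff ℝ ∞ (deriv p) := (contDiff_infty_iff_deriv.1 hp).2
  have hpf' : LocallyIntegrable fun x => p x * f' x := h.2.1.continuous_mul hp.continuous
  have hp'f : LocallyIntegrable fun x => deriv p x * f x := h.1.continuous_mul hp'.continuous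
  refine ⟨h.1.continuous_mul hp.continuous, hp'f.add hpf', fun ζ hζ hζ' => ?_⟩
  have ht : IsTest ζ := ⟨hζ, hζ'⟩
  have hprod (x : ℝ) : deriv (fun x => p x * ζ x) x = deriv p x * ζ x + p x * deriv ζ x :=
    ((hp.differentiable (by simp) x).hasDerivAt.mul (ht.hasDerivAt x)).deriv
  have hint := h.integral_mul_deriv (ht.mul_left hp)
  simp only [hprod, mul_add] at hint
  rw [integral_add ((ht.mul_left hp').integrable_mul h.1)
    ((ht.deriv.mul_left hp).integrable_mul h.1)] at hint
  simp only [add_mul]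
  rw [integral_add (ht.integrable_mul hp'f) (ht.integrable_mul hpf')]
  simp only [mul_right_comm (p _) _ (deriv ζ _), mul_right_comm (p _) _ (ζ _),
    mul_right_comm (deriv p _) _ (ζ _), mul_comm (p _ * _), mul_comm (deriv p _ * _)]
  linarith

end IsWeakDeriv

theorem isWeakDeriv_primitive {f : ℝ → ℝ} (hf : LocallyIntegrable f) :
    IsWeakDeriv (fun x => ∫ t in (0 : ℝ)..x, f t) f :=
  ⟨(intervalIntegral.continuous_primitive
    (intervalIntegrable_of_locallyIntegrable hf) 0).locallyIntegrable, hf,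
    fun _ hη hη' => integral_primitive_mul_deriv hf ⟨hη, hη'⟩⟩

theorem isWeakDeriv_of_hasDerivAt {u v : ℝ → ℝ} (hu : ∀ x, HasDerivAt u (v x) x)
    (hv : Continuous v) : IsWeakDeriv u v := by
  have hconst : IsWeakDeriv (fun _ => u 0) 0 := by
    refine ⟨locallyIntegrable_const _, locallyIntegrable_zero, fun η hη hη' => ?_⟩
    have ht : IsTest η := ⟨hη, hη'⟩
    rw [integral_const_mul, integral_eq_zero_of_hasDerivAt_of_integrable ht.hasDerivAt
      ht.deriv.integrable ht.integrable]
    simp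
  refine (hconst.add (isWeakDeriv_primitive hv.locallyIntegrable)).congr
    (ae_of_all _ fun x => ?_) (ae_of_all _ fun x => by simp)
  beta_reduce
  rw [intervalIntegral.integral_eq_sub_of_hasDerivAt (fun x _ => hu x) (hv.intervalIntegrable _ _),
    add_sub_cancel]

namespace IsWeakDeriv

variable {f f' : ℝ → ℝ}

theorem exists_ae_eq_primitive (h : IsWeakDeriv f f') :
    ∃ c : ℝ, f =ᵐ[volume] fun x => c + ∫ t in (0 : ℝ)..x, f' t := by
  have hp := isWeakDeriv_primitive h.2.1
  obtain ⟨c, hc⟩ := exists_ae_eq_const_of_integral_mul_deriv_eq_zero (h.1.sub hp.1)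
    fun η hη => by
      simp only [Pi.sub_apply, sub_mul]
      rw [integral_sub (hη.deriv.integrable_mul h.1) (hη.deriv.integrable_mul hp.1),
        h.integral_mul_deriv hη, hp.integral_mul_deriv hη, sub_self]
  exact ⟨c, hc.mono fun x hx => eq_add_of_sub_eq hx⟩

theorem exists_hasDerivAt {v : ℝ → ℝ} (h : IsWeakDeriv f f') (hf' : f' =ᵐ[volume] v)
    (hv : Continuous v) : ∃ u : ℝ → ℝ, f =ᵐ[volume] u ∧ ∀ x, HasDerivAt u (v x) x := by
  obtain ⟨c, hc⟩ := (h.congr EventuallyEq.rfl hf').exists_ae_eq_primitive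
  exact ⟨_, hc, fun x => ((hv.integral_hasStrictDerivAt 0 x).hasDerivAt.const_add c)⟩

theorem exists_continuous (h : IsWeakDeriv f f') :
    ∃ u : ℝ → ℝ, f =ᵐ[volume] u ∧ Continuous u := by
  obtain ⟨c, hc⟩ := h.exists_ae_eq_primitive
  exact ⟨_, hc, continuous_const.add
    (intervalIntegral.continuous_primitive (intervalIntegrable_of_locallyIntegrable h.2.1) 0)⟩

end IsWeakDeriv

/-- The weak equation `A'' - B' + C = 0`, integrated once. -/
theorem exists_isWeakDeriv_of_integral_eq_zero {A B C : ℝ → ℝ} (hA : LocallyIntegrable A)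
    (hB : LocallyIntegrable B) (hC : LocallyIntegrable C)
    (h : ∀ η, IsTest η → (∫ x, A x * deriv (deriv η) x) + (∫ x, B x * deriv η x)
      + ∫ x, C x * η x = 0) :
    ∃ D, IsWeakDeriv D C ∧ IsWeakDeriv A (fun x => B x - D x) := by
  obtain ⟨θ, hθ, hθ1⟩ := exists_isTest_integral_eq_one
  have hQ := isWeakDeriv_primitive hC
  set Q : ℝ → ℝ := fun x => ∫ t in (0 : ℝ)..x, C t
  have hBQ : LocallyIntegrable fun x => B x - Q x := hB.sub hQ.1
  set κ : ℝ := (∫ x, A x * deriv θ x) + ∫ x, (B x - Q x) * θ x with hκ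
  have hD : IsWeakDeriv (fun x => κ + Q x) C :=
    ((isWeakDeriv_of_hasDerivAt (fun x => hasDerivAt_const x κ) continuous_const).add hQ).congr
      EventuallyEq.rfl (ae_of_all _ fun x => zero_add _)
  refine ⟨_, hD, hA, hB.sub hD.1, fun ζ hζ hζ' => ?_⟩
  have ht : IsTest ζ := ⟨hζ, hζ'⟩
  obtain ⟨η, hη, hηζ⟩ := ht.exists_eq_deriv_add hθ hθ1
  have hderiv : deriv ζ = fun x => deriv (deriv η) x + (∫ t, ζ t) * deriv θ x := by
    conv_lhs => rw [hηζ]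
    exact funext fun x => ((hη.deriv.hasDerivAt x).add ((hθ.hasDerivAt x).const_mul _)).deriv
  have hAζ : ∫ x, A x * deriv ζ x
      = (∫ x, A x * deriv (deriv η) x) + (∫ t, ζ t) * ∫ x, A x * deriv θ x := by
    rw [hderiv, IsTest.integral_mul_add_const_mul hA hη.deriv.deriv hθ.deriv]
  have hBQζ : ∫ x, (B x - Q x) * ζ x
      = (∫ x, B x * deriv η x) + (∫ x, C x * η x) + (∫ t, ζ t) * ∫ x, (B x - Q x) * θ x := by
    conv_lhs => rw [hηζ]
    rw [IsTest.integral_mul_add_const_mul hBQ hη.deriv hθ]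
    simp only [sub_mul (B _), integral_sub (hη.deriv.integrable_mul hB)
      (hη.deriv.integrable_mul hQ.1), hQ.integral_mul_deriv hη, sub_neg_eq_add]
  have hBD : ∫ x, (B x - (κ + Q x)) * ζ x = (∫ x, (B x - Q x) * ζ x) - κ * ∫ t, ζ t := by
    rw [← integral_const_mul, ← integral_sub (ht.integrable_mul hBQ) (ht.integrable.const_mul κ)]
    exact integral_congr_ae (ae_of_all _ fun x => by ring)
  rw [hAζ, hBD, hBQζ, hκ]
  linarith [h η hη]

/-! ### Multipliers of Sobolev spaces -/

/-- A multiplier of all spaces `H^k(ℝ)`: smooth and bounded, with compactly supported derivative. -/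
structure IsMultiplier (p : ℝ → ℝ) : Prop where
  smooth : ContDiff ℝ ∞ p
  bounded : MemLp p ⊤ volume
  compact_deriv : HasCompactSupport (deriv p)

theorem IsRTProfile.isMultiplier {ρ : ℝ → ℝ} (hρ : IsRTProfile ρ) : IsMultiplier ρ :=
  ⟨hρ.smooth, hρ.bounded, hρ.compact_deriv⟩

theorem IsTest.isMultiplier {η : ℝ → ℝ} (hη : IsTest η) : IsMultiplier η :=
  ⟨hη.smooth, hη.memLp ⊤, hη.compact.deriv⟩

theorem isMultiplier_const (c : ℝ) : IsMultiplier fun _ => c :=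
  ⟨contDiff_const, memLp_top_const c, by
    rw [deriv_const']
    exact HasCompactSupport.zero⟩

theorem MemH.of_succ {k : ℕ} {f : ℝ → ℝ} (hf : MemH (k + 1) f) : MemH k f := by
  induction k generalizing f with
  | zero => exact hf.1
  | succ k ih => exact ⟨hf.1, hf.2.imp fun _ h => ⟨h.1, ih h.2⟩⟩

theorem MemH.add {k : ℕ} {f g : ℝ → ℝ} (hf : MemH k f) (hg : MemH k g) :
    MemH k fun x => f x + g x := by
  induction k generalizing f g with
  | zero => exact MemLp.add hf hg
  | succ k ih =>
    obtain ⟨hf, f', hf', hf'k⟩ := hf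
    obtain ⟨hg, g', hg', hg'k⟩ := hg
    exact ⟨hf.add hg, _, hf'.add hg', ih hf'k hg'k⟩

namespace IsMultiplier

variable {p q f : ℝ → ℝ}

theorem isTest_deriv (hp : IsMultiplier p) : IsTest (deriv p) :=
  ⟨(contDiff_infty_iff_deriv.1 hp.smooth).2, hp.compact_deriv⟩

theorem add (hp : IsMultiplier p) (hq : IsMultiplier q) : IsMultiplier fun x => p x + q x := by
  refine ⟨hp.smooth.add hq.smooth, hp.bounded.add hq.bounded, ?_⟩
  have hderiv : deriv (fun x => p x + q x) = deriv p + deriv q := funext fun x =>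
    deriv_fun_add (hp.smooth.differentiable (by simp) x) (hq.smooth.differentiable (by simp) x)
  rw [hderiv]
  exact hp.compact_deriv.add hq.compact_deriv

theorem const_mul (hp : IsMultiplier p) (c : ℝ) : IsMultiplier fun x => c * p x := by
  refine ⟨contDiff_const.mul hp.smooth, hp.bounded.const_mul c, ?_⟩
  have hderiv : deriv (fun x => c * p x) = fun x => c * deriv p x :=
    funext fun x => deriv_const_mul c (hp.smooth.differentiable (by simp) x)
  rw [hderiv]
  exact hp.compact_deriv.mul_left

theorem mul_memLp (hp : IsMultiplier p) (hf : MemLp f 2 volume) :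
    MemLp (fun x => p x * f x) 2 volume :=
  hf.mul' hp.bounded

theorem memH_mul {k : ℕ} (hp : IsMultiplier p) (hf : MemH k f) : MemH k fun x => p x * f x := by
  induction k generalizing p f with
  | zero => exact hp.mul_memLp hf
  | succ k ih =>
    have hfk := hf.of_succ
    obtain ⟨hf, f', hf', hf'k⟩ := hf
    exact ⟨hp.mul_memLp hf, _, hf'.smooth_mul hp.smooth,
      (ih hp.isTest_deriv.isMultiplier hfk).add (ih hp hf'k)⟩

end IsMultiplier

theorem MemH.const_mul {k : ℕ} {f : ℝ → ℝ} (hf : MemH k f) (c : ℝ) : MemH k fun x => c * f x :=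
  (isMultiplier_const c).memH_mul hf

/-! ### Degenerate parameters of quadratic pencils -/

section Pencil

variable {V : Type*} [NormedAddCommGroup V] [NormedSpace ℝ V]

theorem abs_apply_self_le_of_norm_eq_one (q : V →L[ℝ] V →L[ℝ] ℝ) {x : V} (hx : ‖x‖ = 1) :
    |q x x| ≤ ‖q‖ := by
  simpa [hx] using q.le_opNorm₂ x x

theorem apply_eq_zero_of_apply_self_eq_zero {q : V →L[ℝ] V →L[ℝ] ℝ}
    (hsymm : ∀ x y, q x y = q y x) (hq : ∀ x, 0 ≤ q x x) {u : V} (hu : q u u = 0) (y : V) :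
    q u y = 0 := by
  have hcs : q u y ^ 2 ≤ q u u * q y y := q.toBilinForm.apply_sq_le_of_symm hq ⟨hsymm⟩ u y
  rw [hu, zero_mul] at hcs
  exact pow_eq_zero_iff two_ne_zero |>.1 (le_antisymm hcs (sq_nonneg _))

/-- Sequential compactness of a bilinear form: every sequence in the unit ball has a subsequence
whose differences become small for the associated quadratic form. -/
def IsCompactForm (b : V →L[ℝ] V →L[ℝ] ℝ) : Prop :=
  ∀ x : ℕ → V, (∀ n, ‖x n‖ ≤ 1) → ∃ φ : ℕ → ℕ, StrictMono φ ∧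
    ∀ ε > 0, ∃ N, ∀ m ≥ N, ∀ n ≥ N, b (x (φ m) - x (φ n)) (x (φ m) - x (φ n)) < ε

theorem exists_ne_zero_apply_self_eq_zero [CompleteSpace V] {q b : V →L[ℝ] V →L[ℝ] ℝ}
    (hq : ∀ x, 0 ≤ q x x) (hb : IsCompactForm b) {γ : ℝ} (hγ : 0 < γ)
    (hcoer : ∀ x, γ * ‖x‖ ^ 2 ≤ q x x + b x x) {x : ℕ → V} (hx : ∀ n, ‖x n‖ = 1)
    (hqx : Tendsto (fun n => q (x n) (x n)) atTop (𝓝 0)) : ∃ u, u ≠ 0 ∧ q u u = 0 := by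
  obtain ⟨φ, hφ, hbφ⟩ := hb x fun n => (hx n).le
  have hqφ := hqx.comp hφ.tendsto_atTop
  have hparallelogram (y z : V) : q (y - z) (y - z) ≤ 2 * q y y + 2 * q z z := by
    have := hq (y + z)
    simp only [map_add, map_sub, _root_.add_apply, _root_.sub_apply] at this ⊢
    linarith
  have hcauchy : CauchySeq fun n => x (φ n) := by
    rw [Metric.cauchySeq_iff]
    intro ε hε
    have hε' : 0 < γ * ε ^ 2 / 5 := by positivity
    obtain ⟨N₁, hN₁⟩ := hbφ _ hε'
    obtain ⟨N₂, hN₂⟩ := eventually_atTop.1 (hqφ.eventually_lt_const hε')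
    simp only [Function.comp_apply] at hN₂
    refine ⟨max N₁ N₂, fun m hm n hn => ?_⟩
    have hbmn := hN₁ m (le_of_max_le_left hm) n (le_of_max_le_left hn)
    have hqm := hN₂ m (le_of_max_le_right hm)
    have hqn := hN₂ n (le_of_max_le_right hn)
    have hlt : γ * ‖x (φ m) - x (φ n)‖ ^ 2 < γ * ε ^ 2 := by
      linarith [hcoer (x (φ m) - x (φ n)), hparallelogram (x (φ m)) (x (φ n))]
    rw [dist_eq_norm]
    exact lt_of_pow_lt_pow_left₀ 2 hε.le (lt_of_mul_lt_mul_left hlt hγ.le)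
  obtain ⟨u, hu⟩ := cauchySeq_tendsto_of_complete hcauchy
  have hnorm : ‖u‖ = 1 := tendsto_nhds_unique hu.norm (by simp [hx])
  have hcont : Continuous fun y => q y y := by fun_prop
  exact ⟨u, norm_ne_zero_iff.1 (hnorm ▸ one_ne_zero),
    tendsto_nhds_unique ((hcont.tendsto u).comp hu) hqφ⟩

/-- The quadratic pencil `s² j + s e + a`. -/
def pencil (j e a : V →L[ℝ] V →L[ℝ] ℝ) (s : ℝ) : V →L[ℝ] V →L[ℝ] ℝ :=
  s ^ 2 • j + s • e + a

variable {j e a b : V →L[ℝ] V →L[ℝ] ℝ} {δ K : ℝ}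

theorem pencil_apply (j e a : V →L[ℝ] V →L[ℝ] ℝ) (s : ℝ) (x y : V) :
    pencil j e a s x y = s ^ 2 * j x y + s * e x y + a x y := rfl

theorem exists_gt_pencil_apply_self_neg {s : ℝ} {x : V} (hx : pencil j e a s x x < 0) :
    ∃ t > s, pencil j e a t x x < 0 := by
  have hcont : Continuous fun t => pencil j e a t x x := by
    simp only [pencil_apply]
    fun_prop
  have hev : ∀ᶠ t in 𝓝[>] s, pencil j e a t x x < 0 :=
    (hcont.continuousAt.eventually_lt continuousAt_const hx).filter_mono nhdsWithin_le_nhds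
  obtain ⟨t, ht, hst⟩ := (hev.and self_mem_nhdsWithin).exists
  exact ⟨t, hst, ht⟩

theorem exists_norm_eq_one_apply_self_neg {q : V →L[ℝ] V →L[ℝ] ℝ} {x : V} (hx : q x x < 0) :
    ∃ y, ‖y‖ = 1 ∧ q y y < 0 := by
  have hx0 : x ≠ 0 := by
    rintro rfl
    simp at hx
  have hinv : 0 < ‖x‖⁻¹ := by positivity
  refine ⟨‖x‖⁻¹ • x, norm_smul_inv_norm hx0, ?_⟩
  simp only [map_smul, _root_.smul_apply, smul_eq_mul]
  exact mul_neg_of_pos_of_neg hinv (mul_neg_of_pos_of_neg hinv hx)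

theorem pencil_apply_self_sub_le (s t : ℝ) {x : V} (hx : ‖x‖ = 1) :
    pencil j e a s x x - pencil j e a t x x ≤ |s ^ 2 - t ^ 2| * ‖j‖ + |s - t| * ‖e‖ := by
  have hj := abs_apply_self_le_of_norm_eq_one j hx
  have he := abs_apply_self_le_of_norm_eq_one e hx
  calc pencil j e a s x x - pencil j e a t x x
      = (s ^ 2 - t ^ 2) * j x x + (s - t) * e x x := by
        rw [pencil_apply, pencil_apply]
        ring
    _ ≤ _ := by
        refine add_le_add ((le_abs_self _).trans ?_) ((le_abs_self _).trans ?_) <;> rw [abs_mul] <;>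
          gcongr

-- The parameter is the least one from which on the pencil is nonnegative.
theorem exists_pencil_tendsto_zero {u₀ : V} (hu₀ : a u₀ u₀ < 0) {S : ℝ}
    (hS : ∀ s, S ≤ s → ∀ x, 0 ≤ pencil j e a s x x) :
    ∃ s > 0, (∀ x, 0 ≤ pencil j e a s x x) ∧ ∃ x : ℕ → V, (∀ n, ‖x n‖ = 1) ∧
      Tendsto (fun n => pencil j e a s (x n) (x n)) atTop (𝓝 0) := by
  have hzero : pencil j e a 0 u₀ u₀ < 0 := by simpa [pencil_apply] using hu₀
  let T : Set ℝ := {s | ∃ x, pencil j e a s x x < 0}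
  have hT : BddAbove T :=
    ⟨S, fun s ⟨x, hx⟩ => not_lt.1 fun h => (hS s h.le x).not_gt hx⟩
  have hpos : 0 < sSup T := by
    obtain ⟨t, ht, htx⟩ := exists_gt_pencil_apply_self_neg hzero
    exact ht.trans_le (le_csSup hT ⟨u₀, htx⟩)
  have hnonneg (x : V) : 0 ≤ pencil j e a (sSup T) x x := by
    by_contra! hneg
    obtain ⟨t, ht, htx⟩ := exists_gt_pencil_apply_self_neg hneg
    exact (le_csSup hT ⟨x, htx⟩).not_gt ht
  obtain ⟨s, -, hsT, hs⟩ := exists_seq_tendsto_sSup (S := T) ⟨0, u₀, hzero⟩ hT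
  choose x hx hneg using fun n => exists_norm_eq_one_apply_self_neg (hs n).choose_spec
  have hlim : Tendsto (fun n => |sSup T ^ 2 - s n ^ 2| * ‖j‖ + |sSup T - s n| * ‖e‖)
      atTop (𝓝 0) := by
    have hcont : Continuous fun t => |sSup T ^ 2 - t ^ 2| * ‖j‖ + |sSup T - t| * ‖e‖ := by
      fun_prop
    simpa [Function.comp_def] using (hcont.tendsto (sSup T)).comp hsT
  exact ⟨sSup T, hpos, hnonneg, x, hx, squeeze_zero (fun n => hnonneg _) (fun n => by
    linarith [hneg n, pencil_apply_self_sub_le (j := j) (e := e) (a := a) (sSup T) (s n) (hx n)])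
    hlim⟩

theorem exists_pencil_apply_self_eq_zero [CompleteSpace V] (hj : ∀ x, 0 ≤ j x x)
    (hδ : 0 < δ) (he : ∀ x, δ * ‖x‖ ^ 2 ≤ e x x) (ha : ∀ x, 0 ≤ a x x + b x x)
    (hb : ∀ x, b x x ≤ K * j x x) (hcomp : IsCompactForm b) {u₀ : V} (hu₀ : a u₀ u₀ < 0) :
    ∃ s > 0, (∀ x, 0 ≤ pencil j e a s x x) ∧ ∃ u, u ≠ 0 ∧ pencil j e a s u u = 0 := by
  have he0 (x : V) : 0 ≤ e x x := le_trans (by positivity) (he x)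
  obtain ⟨s, hs, hnonneg, x, hx, hlim⟩ := exists_pencil_tendsto_zero (j := j) (e := e) hu₀
    (S := |K| + 1) fun s hs x => by
      have hKs : K ≤ s ^ 2 := by nlinarith [le_abs_self K, abs_nonneg K]
      have hse : 0 ≤ s * e x x := mul_nonneg (by linarith [abs_nonneg K]) (he0 x)
      rw [pencil_apply]
      linarith [mul_le_mul_of_nonneg_right hKs (hj x), hb x, ha x]
  refine ⟨s, hs, hnonneg,
    exists_ne_zero_apply_self_eq_zero hnonneg hcomp (mul_pos hs hδ) (fun y => ?_) hx hlim⟩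
  rw [pencil_apply]
  linarith [mul_le_mul_of_nonneg_left (he y) hs.le, mul_nonneg (sq_nonneg s) (hj y), ha y]

-- A null vector `u` can be normalized by `j`: if `j u u = 0`, then `b ≤ K j` gives `0 ≤ a u u`,
-- against the coercivity of `e`.
theorem exists_critical_parameter [CompleteSpace V] (hj_symm : ∀ x y, j x y = j y x)
    (he_symm : ∀ x y, e x y = e y x) (ha_symm : ∀ x y, a x y = a y x) (hj : ∀ x, 0 ≤ j x x)
    (hδ : 0 < δ) (he : ∀ x, δ * ‖x‖ ^ 2 ≤ e x x) (ha : ∀ x, 0 ≤ a x x + b x x)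
    (hb : ∀ x, b x x ≤ K * j x x) (hcomp : IsCompactForm b) {u₀ : V} (hu₀ : a u₀ u₀ < 0) :
    ∃ s > 0, (∀ x, 0 ≤ pencil j e a s x x) ∧
      ∃ u, j u u = 1 ∧ ∀ y, pencil j e a s u y = 0 := by
  obtain ⟨s, hs, hnonneg, u, hu, hu0⟩ :=
    exists_pencil_apply_self_eq_zero hj hδ he ha hb hcomp hu₀
  have hker := apply_eq_zero_of_apply_self_eq_zero (fun x y => by
    rw [pencil_apply, pencil_apply, hj_symm, he_symm, ha_symm]) hnonneg hu0
  have hpos : 0 < j u u := by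
    refine (hj u).lt_of_ne fun h0 => ?_
    have hbu := hb u
    rw [pencil_apply, ← h0] at hu0
    rw [← h0, mul_zero] at hbu
    have hδu : 0 < δ * ‖u‖ ^ 2 := by positivity
    linarith [mul_pos hs (hδu.trans_le (he u)), ha u]
  refine ⟨s, hs, hnonneg, (√(j u u))⁻¹ • u, ?_, fun y => ?_⟩
  · simp only [map_smul, _root_.smul_apply, smul_eq_mul]
    rw [← mul_assoc, ← mul_inv, Real.mul_self_sqrt hpos.le, inv_mul_cancel₀ hpos.ne']
  · simp only [map_smul, _root_.smul_apply, hker y, smul_zero]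

end Pencil

/-! ### The Sobolev space `H²(ℝ)` as a Hilbert space of jets -/

/-- The real Hilbert space `L²(ℝ)`. -/
abbrev L2 := Lp ℝ 2 (volume : Measure ℝ)

theorem L2.locallyIntegrable (f : L2) : LocallyIntegrable f volume :=
  (Lp.memLp f).locallyIntegrable one_le_two

theorem L2.inner_eq_integral (f g : L2) : ⟪f, g⟫ = ∫ x, f x * g x := by
  simp [L2.inner_def, mul_comm]

theorem L2.inner_toLp {h : ℝ → ℝ} (f : L2) (hh : MemLp h 2 volume) :
    ⟪f, hh.toLp h⟫ = ∫ x, f x * h x := by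
  rw [L2.inner_eq_integral]
  exact integral_congr_ae (EventuallyEq.rfl.mul hh.coeFn_toLp)

theorem norm_sq_eq_integral {f : L2} {ψ : ℝ → ℝ} (h : f =ᵐ[volume] ψ) :
    ‖f‖ ^ 2 = ∫ x, ψ x ^ 2 := by
  rw [← real_inner_self_eq_norm_sq, L2.inner_eq_integral]
  simp only [← sq]
  exact integral_congr_ae (h.pow_const 2)

section MulForm

variable {m m' : ℝ → ℝ}

/-- The bilinear form `(f, g) ↦ ∫ m f g` on `L²` for a bounded weight `m`. -/
def mulForm (hm : MemLp m ⊤ volume) : L2 →L[ℝ] L2 →L[ℝ] ℝ :=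
  (ContinuousLinearMap.lsmul ℝ ℝ).lpPairing volume 2 2 ∘L
    (ContinuousLinearMap.lsmul ℝ ℝ).holderL volume ⊤ 2 2 (hm.toLp m)

theorem mulForm_apply (hm : MemLp m ⊤ volume) (f g : L2) :
    mulForm hm f g = ∫ x, m x * f x * g x := by
  have hmul := (ContinuousLinearMap.lsmul ℝ ℝ).coeFn_holder (r := 2) (hm.toLp m) f
  rw [mulForm, ContinuousLinearMap.comp_apply, ContinuousLinearMap.lpPairing_eq_integral,
    ContinuousLinearMap.holderL_apply_apply]
  refine integral_congr_ae ?_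
  filter_upwards [hmul, hm.coeFn_toLp] with x hx hmx
  rw [hx, hmx]
  simp only [ContinuousLinearMap.lsmul_apply, smul_eq_mul]

theorem mulForm_eq_integral (hm : MemLp m ⊤ volume) {f : L2} {ψ : ℝ → ℝ} (h : f =ᵐ[volume] ψ) :
    mulForm hm f f = ∫ x, m x * ψ x ^ 2 := by
  rw [mulForm_apply]
  simp only [mul_assoc, ← sq]
  exact integral_congr_ae (EventuallyEq.rfl.mul (h.pow_const 2))

theorem mulForm_symm (hm : MemLp m ⊤ volume) (f g : L2) : mulForm hm f g = mulForm hm g f := by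
  simp only [mulForm_apply, mul_right_comm]

theorem integrable_mul_sq (hm : MemLp m ⊤ volume) {f : ℝ → ℝ} (hf : MemLp f 2 volume) :
    Integrable fun x => m x * f x ^ 2 := by
  simpa only [sq, mul_assoc, Pi.mul_def] using (hf.mul' hm (r := 2)).integrable_mul hf

theorem mulForm_mono (hm : MemLp m ⊤ volume) (hm' : MemLp m' ⊤ volume) (h : ∀ x, m x ≤ m' x)
    (f : L2) : mulForm hm f f ≤ mulForm hm' f f := by
  rw [mulForm_eq_integral hm EventuallyEq.rfl, mulForm_eq_integral hm' EventuallyEq.rfl]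
  exact integral_mono (integrable_mul_sq hm (Lp.memLp f)) (integrable_mul_sq hm' (Lp.memLp f))
    fun x => mul_le_mul_of_nonneg_right (h x) (sq_nonneg _)

theorem mulForm_const_self (c : ℝ) (f : L2) :
    mulForm (memLp_top_const (μ := volume) c) f f = c * ‖f‖ ^ 2 := by
  rw [mulForm_eq_integral _ EventuallyEq.rfl, integral_const_mul,
    norm_sq_eq_integral EventuallyEq.rfl]

end MulForm

section WeakGraph

/-- A test function as an element of `L²`. -/
def IsTest.toL2 {η : ℝ → ℝ} (hη : IsTest η) : L2 := (hη.memLp 2).toLp η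

theorem isWeakDeriv_iff_inner {f g : L2} :
    IsWeakDeriv f g ↔ ∀ η (hη : IsTest η), ⟪f, hη.deriv.toL2⟫ + ⟪g, hη.toL2⟫ = 0 := by
  simp only [IsTest.toL2, L2.inner_toLp, ← eq_neg_iff_add_eq_zero]
  exact ⟨fun h η hη => h.integral_mul_deriv hη, fun h =>
    ⟨L2.locallyIntegrable f, L2.locallyIntegrable g, fun η hη hη' => h η ⟨hη, hη'⟩⟩⟩

/-- The span in `L² × L²` of the pairs `(η, η')` with `η` a test function. -/
def testPairs : Submodule ℝ (WithLp 2 (L2 × L2)) :=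
  Submodule.span ℝ {p | ∃ (η : ℝ → ℝ) (hη : IsTest η), p = WithLp.toLp 2 (hη.toL2, hη.deriv.toL2)}

theorem toLp_mem_testPairs_orthogonal {f g : L2} :
    WithLp.toLp 2 (g, f) ∈ testPairsᗮ ↔ IsWeakDeriv f g := by
  have hinner {η : ℝ → ℝ} (hη : IsTest η) :
      ⟪WithLp.toLp 2 (g, f), WithLp.toLp 2 (hη.toL2, hη.deriv.toL2)⟫
        = ⟪f, hη.deriv.toL2⟫ + ⟪g, hη.toL2⟫ := by
    rw [WithLp.prod_inner_apply, add_comm]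
  rw [isWeakDeriv_iff_inner, Submodule.mem_orthogonal']
  refine ⟨fun h η hη => (hinner hη).symm.trans (h _ (Submodule.subset_span ⟨η, hη, rfl⟩)),
    fun h p hp => ?_⟩
  induction hp using Submodule.span_induction with
  | mem p hp =>
    obtain ⟨η, hη, rfl⟩ := hp
    exact (hinner hη).trans (h η hη)
  | zero => exact inner_zero_right _
  | add p q _ _ hp hq => rw [inner_add_right, hp, hq, add_zero]
  | smul c p _ hp => rw [inner_smul_right, hp, mul_zero]

/-- The graph of the weak derivative in `L² × L²`, that is `H¹(ℝ)`. -/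
def weakGraph : Submodule ℝ (L2 × L2) :=
  testPairsᗮ.comap ((WithLp.prodContinuousLinearEquiv 2 ℝ L2 L2).symm.toLinearMap ∘ₗ
    (LinearEquiv.prodComm ℝ L2 L2).toLinearMap)

theorem mem_weakGraph {p : L2 × L2} : p ∈ weakGraph ↔ IsWeakDeriv p.1 p.2 :=
  toLp_mem_testPairs_orthogonal

theorem isClosed_weakGraph : IsClosed (weakGraph : Set (L2 × L2)) :=
  testPairs.isClosed_orthogonal.preimage
    ((WithLp.prodContinuousLinearEquiv 2 ℝ L2 L2).symm.continuous.comp continuous_swap)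

end WeakGraph

section Density

theorem eq_zero_of_isWeakDeriv_isWeakDeriv {f g : L2} (hfg : IsWeakDeriv f g)
    (hgf : IsWeakDeriv g f) : f = 0 ∧ g = 0 := by
  obtain ⟨u₀, hfu₀, hu₀⟩ := hfg.exists_continuous
  obtain ⟨w, hgw, hw⟩ := hgf.exists_hasDerivAt hfu₀ hu₀
  have hwc : Continuous w := continuous_iff_continuousAt.2 fun x => (hw x).continuousAt
  obtain ⟨u, hfu, hu⟩ := hfg.exists_hasDerivAt hgw hwc
  have huc : Continuous u := continuous_iff_continuousAt.2 fun x => (hu x).continuousAt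
  obtain rfl : u₀ = u := (hu₀.ae_eq_iff_eq volume huc).1 (hfu₀.symm.trans hfu)
  have huL2 : MemLp u₀ 2 volume := (memLp_congr_ae hfu).1 (Lp.memLp f)
  have hwL2 : MemLp w 2 volume := (memLp_congr_ae hgw).1 (Lp.memLp g)
  have hzero : ∫ x, (w x * w x + u₀ x * u₀ x) = 0 :=
    integral_eq_zero_of_hasDerivAt_of_integrable (fun x => (hu x).mul (hw x))
      ((hwL2.integrable_mul hwL2).add (huL2.integrable_mul huL2)) (huL2.integrable_mul hwL2)
  have hnorm : ‖g‖ ^ 2 + ‖f‖ ^ 2 = 0 := by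
    rw [norm_sq_eq_integral hgw, norm_sq_eq_integral hfu,
      ← integral_add hwL2.integrable_sq huL2.integrable_sq]
    simpa only [sq] using hzero
  constructor <;> rw [← norm_eq_zero] <;> nlinarith [sq_nonneg ‖f‖, sq_nonneg ‖g‖]

theorem testPairs_le_weakGraph :
    testPairs ≤ weakGraph.comap (WithLp.prodContinuousLinearEquiv 2 ℝ L2 L2).toLinearMap := by
  refine Submodule.span_le.2 ?_
  rintro _ ⟨η, hη, rfl⟩
  exact mem_weakGraph.2 ((isWeakDeriv_of_hasDerivAt hη.hasDerivAt hη.deriv.continuous).congr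
    (hη.memLp 2).coeFn_toLp.symm (hη.deriv.memLp 2).coeFn_toLp.symm)

-- A component `y` orthogonal to all test pairs satisfies `y'' = y`.
theorem toLp_mem_closure_testPairs {f g : L2} (h : IsWeakDeriv f g) :
    WithLp.toLp 2 (f, g) ∈ testPairs.topologicalClosure := by
  let K := testPairs.topologicalClosure
  let G := weakGraph.comap (WithLp.prodContinuousLinearEquiv 2 ℝ L2 L2).toLinearMap
  have hKG : K ≤ G := testPairs.topologicalClosure_minimal testPairs_le_weakGraph
    (isClosed_weakGraph.preimage (WithLp.prodContinuousLinearEquiv 2 ℝ L2 L2).continuous)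
  have : CompleteSpace K := testPairs.isClosed_topologicalClosure.completeSpace_coe
  let p := WithLp.toLp 2 (f, g)
  let y := p - K.starProjection p
  have hy : IsWeakDeriv y.fst y.snd := mem_weakGraph.1
    (G.sub_mem (mem_weakGraph.2 h) (hKG (K.starProjection_apply_mem p)))
  have hy' : IsWeakDeriv y.snd y.fst := toLp_mem_testPairs_orthogonal.1
    (Submodule.orthogonal_le testPairs.le_topologicalClosure
      (K.sub_starProjection_mem_orthogonal p))
  obtain ⟨hfst, hsnd⟩ := eq_zero_of_isWeakDeriv_isWeakDeriv hy hy'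
  have hy0 : y = 0 := WithLp.ofLp_injective 2 (Prod.ext hfst hsnd)
  have hp : p = K.starProjection p := sub_eq_zero.1 hy0
  change p ∈ K
  rw [hp]
  exact K.starProjection_apply_mem p

theorem inner_add_inner_eq_zero {f f' g g' : L2} (hf : IsWeakDeriv f f') (hg : IsWeakDeriv g g') :
    ⟪f, g'⟫ + ⟪f', g⟫ = 0 := by
  have hmem := toLp_mem_closure_testPairs hf
  rw [← Submodule.orthogonal_orthogonal_eq_closure] at hmem
  exact Submodule.inner_left_of_mem_orthogonal (toLp_mem_testPairs_orthogonal.2 hg) hmem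

end Density

section SobolevTwo

/-- The Sobolev space `H²(ℝ)` as the space of jets `(u, u', u'')` in `L² × L² × L²`. -/
def sobolevTwo : Submodule ℝ (L2 × L2 × L2) :=
  weakGraph.comap ((LinearMap.fst ℝ L2 (L2 × L2)).prod
      (LinearMap.fst ℝ L2 L2 ∘ₗ LinearMap.snd ℝ L2 (L2 × L2))) ⊓
    weakGraph.comap (LinearMap.snd ℝ L2 (L2 × L2))

instance : CompleteSpace sobolevTwo := by
  have hcont : Continuous fun x : L2 × L2 × L2 => (x.1, x.2.1) := by fun_prop
  exact ((isClosed_weakGraph.preimage hcont).inter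
    (isClosed_weakGraph.preimage continuous_snd)).completeSpace_coe

/-- The underlying function of an element of `H²(ℝ)`. -/
def jet₀ : sobolevTwo →L[ℝ] L2 := ContinuousLinearMap.fst ℝ _ _ ∘L sobolevTwo.subtypeL

/-- The first derivative on `H²(ℝ)`. -/
def jet₁ : sobolevTwo →L[ℝ] L2 :=
  ContinuousLinearMap.fst ℝ _ _ ∘L ContinuousLinearMap.snd ℝ _ _ ∘L sobolevTwo.subtypeL

/-- The second derivative on `H²(ℝ)`. -/
def jet₂ : sobolevTwo →L[ℝ] L2 :=
  ContinuousLinearMap.snd ℝ _ _ ∘L ContinuousLinearMap.snd ℝ _ _ ∘L sobolevTwo.subtypeL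

theorem isWeakDeriv_jet₀ (x : sobolevTwo) : IsWeakDeriv (jet₀ x) (jet₁ x) := mem_weakGraph.1 x.2.1

theorem isWeakDeriv_jet₁ (x : sobolevTwo) : IsWeakDeriv (jet₁ x) (jet₂ x) := mem_weakGraph.1 x.2.2

theorem norm_eq_max_jets (x : sobolevTwo) : ‖x‖ = max ‖jet₀ x‖ (max ‖jet₁ x‖ ‖jet₂ x‖) := rfl

theorem exists_sobolevTwo {f₀ f₁ f₂ : ℝ → ℝ} (h₀ : MemLp f₀ 2 volume) (h₁ : MemLp f₁ 2 volume)
    (h₂ : MemLp f₂ 2 volume) (h : IsWeakDeriv f₀ f₁) (h' : IsWeakDeriv f₁ f₂) :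
    ∃ x : sobolevTwo, jet₀ x = h₀.toLp f₀ ∧ jet₁ x = h₁.toLp f₁ ∧ jet₂ x = h₂.toLp f₂ :=
  ⟨⟨(h₀.toLp f₀, h₁.toLp f₁, h₂.toLp f₂),
    mem_weakGraph.2 (h.congr h₀.coeFn_toLp.symm h₁.coeFn_toLp.symm),
    mem_weakGraph.2 (h'.congr h₁.coeFn_toLp.symm h₂.coeFn_toLp.symm)⟩, rfl, rfl, rfl⟩

theorem MemH.exists_jet₀_ae_eq {ψ : ℝ → ℝ} (h : MemH 2 ψ) :
    ∃ x : sobolevTwo, jet₀ x =ᵐ[volume] ψ := by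
  obtain ⟨h₀, f₁, hw, h₁, f₂, hw', h₂⟩ := h
  obtain ⟨x, hx, -⟩ := exists_sobolevTwo h₀ h₁ h₂ hw hw'
  exact ⟨x, hx ▸ h₀.coeFn_toLp⟩

theorem IsTest.exists_sobolevTwo {η : ℝ → ℝ} (hη : IsTest η) :
    ∃ x : sobolevTwo, jet₀ x = hη.toL2 ∧ jet₁ x = hη.deriv.toL2 ∧ jet₂ x = hη.deriv.deriv.toL2 :=
  RTMHD.exists_sobolevTwo (hη.memLp 2) (hη.deriv.memLp 2) (hη.deriv.deriv.memLp 2)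
    (isWeakDeriv_of_hasDerivAt hη.hasDerivAt hη.deriv.continuous)
    (isWeakDeriv_of_hasDerivAt hη.deriv.hasDerivAt hη.deriv.deriv.continuous)

section Representative

variable {x : sobolevTwo} {ψ : ℝ → ℝ}

theorem memH_two_of_jet₀_ae_eq (h : jet₀ x =ᵐ[volume] ψ) : MemH 2 ψ :=
  ⟨(memLp_congr_ae h).1 (Lp.memLp _), jet₁ x, (isWeakDeriv_jet₀ x).congr h (ae_eq_refl _),
    Lp.memLp _, jet₂ x, isWeakDeriv_jet₁ x, Lp.memLp _⟩

theorem jet₁_ae_eq_weakDeriv (h : jet₀ x =ᵐ[volume] ψ) : jet₁ x =ᵐ[volume] weakDeriv ψ :=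
  ((isWeakDeriv_jet₀ x).congr h (ae_eq_refl _)).weakDeriv_ae_eq.symm

theorem jet₂_ae_eq_weakDeriv (h : jet₀ x =ᵐ[volume] ψ) :
    jet₂ x =ᵐ[volume] weakDeriv (weakDeriv ψ) :=
  ((isWeakDeriv_jet₁ x).congr (jet₁_ae_eq_weakDeriv h) (ae_eq_refl _)).weakDeriv_ae_eq.symm

end Representative

theorem exists_jets_eq_of_mem_testPairs {q : WithLp 2 (L2 × L2)} (hq : q ∈ testPairs) :
    ∃ x : sobolevTwo, jet₀ x = q.fst ∧ jet₁ x = q.snd := by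
  let jets : sobolevTwo →ₗ[ℝ] WithLp 2 (L2 × L2) :=
    (WithLp.prodContinuousLinearEquiv 2 ℝ L2 L2).symm.toLinearMap ∘ₗ (jet₀.prod jet₁).toLinearMap
  have hle : testPairs ≤ jets.range := by
    refine Submodule.span_le.2 ?_
    rintro _ ⟨η, hη, rfl⟩
    obtain ⟨x, h₀, h₁, -⟩ := hη.exists_sobolevTwo
    exact ⟨x, by rw [← h₀, ← h₁]; rfl⟩
  obtain ⟨x, rfl⟩ := hle hq
  exact ⟨x, rfl, rfl⟩

theorem exists_memH_two_of_memH_one {m ψ : ℝ → ℝ} (hm : MemLp m ⊤ volume) {b : ℝ} (hψ : MemH 1 ψ)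
    (h : (∫ x, m x * ψ x ^ 2) + b * (∫ x, weakDeriv ψ x ^ 2) < 0) :
    ∃ χ, MemH 2 χ ∧ (∫ x, m x * χ x ^ 2) + b * (∫ x, weakDeriv χ x ^ 2) < 0 := by
  obtain ⟨hψ, ψ', hw, hψ'⟩ := hψ
  have hψ' : MemLp ψ' 2 volume := hψ'
  let U : Set (WithLp 2 (L2 × L2)) := {q | mulForm hm q.fst q.fst + b * ‖q.snd‖ ^ 2 < 0}
  have hU : IsOpen U := by
    have hfst : Continuous fun q : WithLp 2 (L2 × L2) => q.fst :=
      continuous_fst.comp (WithLp.prod_continuous_ofLp 2 L2 L2)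
    have hsnd : Continuous fun q : WithLp 2 (L2 × L2) => q.snd :=
      continuous_snd.comp (WithLp.prod_continuous_ofLp 2 L2 L2)
    exact isOpen_lt ((((mulForm hm).continuous.comp hfst).clm_apply hfst).add
      (continuous_const.mul (hsnd.norm.pow 2))) continuous_const
  have hmem : WithLp.toLp 2 (hψ.toLp ψ, hψ'.toLp ψ') ∈ U := by
    rw [← mulForm_eq_integral hm hψ.coeFn_toLp,
      ← norm_sq_eq_integral (hψ'.coeFn_toLp.trans hw.weakDeriv_ae_eq.symm)] at h
    exact h
  obtain ⟨q, hqU, hq⟩ := mem_closure_iff.1 (toLp_mem_closure_testPairs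
    (hw.congr hψ.coeFn_toLp.symm hψ'.coeFn_toLp.symm)) U hU hmem
  obtain ⟨x, h₀, h₁⟩ := exists_jets_eq_of_mem_testPairs hq
  refine ⟨jet₀ x, memH_two_of_jet₀_ae_eq (ae_eq_refl _), ?_⟩
  rw [← mulForm_eq_integral hm (ae_eq_refl _),
    ← norm_sq_eq_integral (jet₁_ae_eq_weakDeriv (ae_eq_refl (jet₀ x))), h₀, h₁]
  exact hqU

end SobolevTwo

/-! ### Rellich compactness for compactly supported weights -/

section Rellich

theorem abs_intervalIntegral_le (g : L2) (a b : ℝ) :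
    |∫ t in a..b, g t| ≤ ‖g‖ * √|b - a| := by
  wlog hab : a ≤ b generalizing a b
  · rw [intervalIntegral.integral_symm, abs_neg, abs_sub_comm]
    exact this b a (le_of_not_ge hab)
  rw [intervalIntegral.integral_of_le hab, ← L2.inner_indicatorConstLp_one (𝕜 := ℝ)
    measurableSet_Ioc measure_Ioc_lt_top.ne g, mul_comm]
  refine (abs_real_inner_le_norm _ _).trans_eq ?_
  rw [norm_indicatorConstLp (by norm_num) (by norm_num)]
  simp [Real.sqrt_eq_rpow, Real.volume_real_Ioc_of_le hab, abs_of_nonneg (sub_nonneg.2 hab)]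

theorem continuous_of_holder {u : ℝ → ℝ} {C : ℝ} (hu : ∀ x y, |u x - u y| ≤ C * √|x - y|) :
    Continuous u := by
  refine continuous_iff_continuousAt.2 fun y => ?_
  rw [ContinuousAt, tendsto_iff_dist_tendsto_zero]
  have hlim : Tendsto (fun x => C * √|x - y|) (𝓝 y) (𝓝 0) := by
    have hcont : Continuous fun x => C * √|x - y| := by fun_prop
    simpa using hcont.tendsto y
  exact squeeze_zero (fun _ => dist_nonneg) (fun x => hu x y) hlim

theorem sq_le_of_holder {u : ℝ → ℝ} {C : ℝ} (huL2 : MemLp u 2 volume)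
    (hu : ∀ x y, |u x - u y| ≤ C * √|x - y|) (x : ℝ) :
    u x ^ 2 ≤ 2 * (∫ y, u y ^ 2) + 2 * C ^ 2 := by
  have hcont := continuous_of_holder hu
  have hnear : ∀ y ∈ Set.Icc x (x + 1), u x ^ 2 ≤ 2 * u y ^ 2 + 2 * C ^ 2 := by
    rintro y ⟨hxy, hyx⟩
    have hsqrt : (√|x - y|) ^ 2 ≤ 1 := by
      rw [Real.sq_sqrt (abs_nonneg _), abs_le]
      constructor <;> linarith
    have hsq : (u x - u y) ^ 2 ≤ C ^ 2 := by
      rw [← sq_abs]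
      calc |u x - u y| ^ 2 ≤ (C * √|x - y|) ^ 2 := pow_le_pow_left₀ (abs_nonneg _) (hu x y) 2
        _ = C ^ 2 * (√|x - y|) ^ 2 := mul_pow _ _ _
        _ ≤ C ^ 2 := mul_le_of_le_one_right (sq_nonneg C) hsqrt
    linarith [sq_nonneg (u x - 2 * u y)]
  calc u x ^ 2 = ∫ _ in x..x + 1, u x ^ 2 := by simp
    _ ≤ ∫ y in x..x + 1, (2 * u y ^ 2 + 2 * C ^ 2) :=
        intervalIntegral.integral_mono_on (by linarith) (by simp)
          (Continuous.intervalIntegrable (by fun_prop) _ _) hnear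
    _ = 2 * (∫ y in x..x + 1, u y ^ 2) + 2 * C ^ 2 := by
        rw [intervalIntegral.integral_add (Continuous.intervalIntegrable (by fun_prop) _ _)
          (by simp), intervalIntegral.integral_const_mul]
        simp
    _ ≤ 2 * (∫ y, u y ^ 2) + 2 * C ^ 2 := by
        rw [intervalIntegral.integral_of_le (by linarith)]
        gcongr
        · exact ae_of_all _ fun y => sq_nonneg _
        · exact huL2.integrable_sq
        · exact Measure.restrict_le_self

theorem exists_holder_representative {f g : L2} (h : IsWeakDeriv f g) :
    ∃ u : ℝ → ℝ, f =ᵐ[volume] u ∧ (∀ x y, |u x - u y| ≤ ‖g‖ * √|x - y|) ∧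
      ∀ x, u x ^ 2 ≤ 2 * ‖f‖ ^ 2 + 2 * ‖g‖ ^ 2 := by
  obtain ⟨c, hc⟩ := h.exists_ae_eq_primitive
  have hint := intervalIntegrable_of_locallyIntegrable (L2.locallyIntegrable g)
  have hholder (x y : ℝ) : |(c + ∫ t in (0 : ℝ)..x, g t) - (c + ∫ t in (0 : ℝ)..y, g t)|
      ≤ ‖g‖ * √|x - y| := by
    rw [add_sub_add_left_eq_sub, intervalIntegral.integral_interval_sub_left (hint 0 x) (hint 0 y)]
    exact abs_intervalIntegral_le g y x
  refine ⟨_, hc, hholder, fun x => ?_⟩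
  rw [norm_sq_eq_integral hc]
  exact sq_le_of_holder ((memLp_congr_ae hc).1 (Lp.memLp f)) hholder x

theorem exists_subseq_uniformly_cauchy {u : ℕ → ℝ → ℝ} {B C : ℝ}
    (hu : ∀ n x y, |u n x - u n y| ≤ C * √|x - y|) (hB : ∀ n x, |u n x| ≤ B) (R : ℝ) :
    ∃ φ : ℕ → ℕ, StrictMono φ ∧ ∀ ε > 0, ∃ N, ∀ m ≥ N, ∀ n ≥ N, ∀ x ∈ Set.Icc (-R) R,
      |u (φ m) x - u (φ n) x| ≤ ε := by
  let F (n : ℕ) : BoundedContinuousFunction (Set.Icc (-R) R) ℝ :=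
    .mkOfCompact ⟨fun x => u n x, (continuous_of_holder (hu n)).comp continuous_subtype_val⟩
  have hcompact : IsCompact (closure (Set.range F)) := by
    refine BoundedContinuousFunction.arzela_ascoli (Metric.closedBall 0 B)
      (isCompact_closedBall _ _) _ ?_ ?_
    · rintro _ x ⟨n, rfl⟩
      exact mem_closedBall_zero_iff.2 (hB n x)
    · refine Metric.equicontinuous_of_continuity_modulus (fun d => C * √d) ?_ _ ?_
      · have hcont : Continuous fun d => C * √d := by fun_prop
        simpa using hcont.tendsto 0
      · rintro x y ⟨_, n, rfl⟩
        exact hu n x y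
  obtain ⟨_, -, φ, hφ, hlim⟩ :=
    hcompact.tendsto_subseq fun n => subset_closure (Set.mem_range_self n)
  refine ⟨φ, hφ, fun ε hε => ?_⟩
  obtain ⟨N, hN⟩ := Metric.cauchySeq_iff.1 hlim.cauchySeq ε hε
  exact ⟨N, fun m hm n hn x hx =>
    (BoundedContinuousFunction.dist_coe_le_dist (f := F (φ m)) (g := F (φ n)) ⟨x, hx⟩).trans
      (hN m hm n hn).le⟩

theorem mulForm_self_le {m u : ℝ → ℝ} (hm : IsTest m) {f : L2} (hu : f =ᵐ[volume] u) {d : ℝ}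
    (hd : ∀ x ∈ tsupport m, |u x| ≤ d) : mulForm (hm.memLp ⊤) f f ≤ (∫ x, |m x|) * d ^ 2 := by
  have huL2 : MemLp u 2 volume := (memLp_congr_ae hu).1 (Lp.memLp f)
  rw [mulForm_eq_integral _ hu, ← integral_mul_const]
  refine integral_mono (integrable_mul_sq (hm.memLp ⊤) huL2) (hm.integrable.abs.mul_const _)
    fun x => ?_
  by_cases hx : x ∈ tsupport m
  · have hsq : u x ^ 2 ≤ d ^ 2 := sq_le_sq' (abs_le.1 (hd x hx)).1 (abs_le.1 (hd x hx)).2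
    exact mul_le_mul (le_abs_self _) hsq (sq_nonneg _) (abs_nonneg _)
  · simp [image_eq_zero_of_notMem_tsupport hx]

theorem isCompactForm_mulForm {m : ℝ → ℝ} (hm : IsTest m) :
    IsCompactForm ((mulForm (hm.memLp ⊤)).bilinearComp jet₀ jet₀) := by
  intro x hx
  choose u hfu hu hB using fun n => exists_holder_representative (isWeakDeriv_jet₀ (x n))
  have h₀ (n : ℕ) : ‖jet₀ (x n)‖ ≤ 1 := (le_max_left _ _).trans (hx n)
  have h₁ (n : ℕ) : ‖jet₁ (x n)‖ ≤ 1 :=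
    ((le_max_left _ _).trans (le_max_right _ _)).trans (hx n)
  obtain ⟨R, -, hR⟩ := hm.exists_tsupport_subset
  obtain ⟨φ, hφ, hcauchy⟩ := exists_subseq_uniformly_cauchy (u := u) (B := 2) (C := 1)
    (fun n y z => (hu n y z).trans (mul_le_mul_of_nonneg_right (h₁ n) (Real.sqrt_nonneg _)))
    (fun n y => abs_le_of_sq_le_sq (by
      nlinarith [hB n y, h₀ n, h₁ n, norm_nonneg (jet₀ (x n)), norm_nonneg (jet₁ (x n))])
      zero_le_two) R
  refine ⟨φ, hφ, fun ε hε => ?_⟩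
  obtain ⟨d, hd, hdε⟩ : ∃ d > 0, (∫ y, |m y|) * d ^ 2 < ε := by
    have hcont : Continuous fun d : ℝ => (∫ y, |m y|) * d ^ 2 := by fun_prop
    have hev : ∀ᶠ d in 𝓝[>] (0 : ℝ), (∫ y, |m y|) * d ^ 2 < ε :=
      (hcont.continuousAt.eventually_lt continuousAt_const (by simpa using hε)).filter_mono
        nhdsWithin_le_nhds
    obtain ⟨d, hd, hd0⟩ := (hev.and self_mem_nhdsWithin).exists
    exact ⟨d, hd0, hd⟩
  obtain ⟨N, hN⟩ := hcauchy d hd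
  refine ⟨N, fun p hp n hn => lt_of_le_of_lt ?_ hdε⟩
  have hfu' : jet₀ (x (φ p) - x (φ n)) =ᵐ[volume] fun y => u (φ p) y - u (φ n) y := by
    rw [map_sub]
    exact (Lp.coeFn_sub _ _).trans ((hfu (φ p)).sub (hfu (φ n)))
  exact mulForm_self_le hm hfu' fun y hy => hN p hp n hn y (Set.Ioo_subset_Icc_self (hR hy))

end Rellich

/-! ### The energies as quadratic forms on `H²(ℝ)` -/

section Forms

/-- The form `∫ c₀ u v + c₁ u' v' + c₂ u'' v''` with constant coefficients. -/
def jetForm (c₀ c₁ c₂ : ℝ) : sobolevTwo →L[ℝ] sobolevTwo →L[ℝ] ℝ :=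
  c₀ • (innerSL ℝ).bilinearComp jet₀ jet₀ + c₁ • (innerSL ℝ).bilinearComp jet₁ jet₁ +
    c₂ • (innerSL ℝ).bilinearComp jet₂ jet₂

theorem jetForm_apply (c₀ c₁ c₂ : ℝ) (x y : sobolevTwo) :
    jetForm c₀ c₁ c₂ x y =
      c₀ * ⟪jet₀ x, jet₀ y⟫ + c₁ * ⟪jet₁ x, jet₁ y⟫ + c₂ * ⟪jet₂ x, jet₂ y⟫ := rfl

theorem jetForm_symm (c₀ c₁ c₂ : ℝ) (x y : sobolevTwo) :
    jetForm c₀ c₁ c₂ x y = jetForm c₀ c₁ c₂ y x := by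
  simp only [jetForm_apply, real_inner_comm]

theorem jetForm_apply_self (c₀ c₁ c₂ : ℝ) (x : sobolevTwo) :
    jetForm c₀ c₁ c₂ x x = c₀ * ‖jet₀ x‖ ^ 2 + c₁ * ‖jet₁ x‖ ^ 2 + c₂ * ‖jet₂ x‖ ^ 2 := by
  simp only [jetForm_apply, real_inner_self_eq_norm_sq]

theorem mul_norm_sq_le_jetForm {c c₀ c₁ c₂ : ℝ} (hc : 0 ≤ c) (h₀ : c ≤ c₀) (h₁ : c ≤ c₁)
    (h₂ : c ≤ c₂) (x : sobolevTwo) : c * ‖x‖ ^ 2 ≤ jetForm c₀ c₁ c₂ x x := by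
  have hnorm : ‖x‖ ^ 2 ≤ ‖jet₀ x‖ ^ 2 + ‖jet₁ x‖ ^ 2 + ‖jet₂ x‖ ^ 2 := by
    have := sq_nonneg ‖jet₀ x‖
    have := sq_nonneg ‖jet₁ x‖
    have := sq_nonneg ‖jet₂ x‖
    rw [norm_eq_max_jets]
    rcases max_choice ‖jet₀ x‖ (max ‖jet₁ x‖ ‖jet₂ x‖) with h | h <;> rw [h]
    · linarith
    · rcases max_choice ‖jet₁ x‖ ‖jet₂ x‖ with h | h <;> rw [h] <;> linarith
  calc c * ‖x‖ ^ 2 ≤ c * ‖jet₀ x‖ ^ 2 + c * ‖jet₁ x‖ ^ 2 + c * ‖jet₂ x‖ ^ 2 := by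
        linarith [mul_le_mul_of_nonneg_left hnorm hc]
    _ ≤ jetForm c₀ c₁ c₂ x x := by
        rw [jetForm_apply_self]
        gcongr

/-- The bilinear form of the functional `J`, with `k` in place of `|ξ|²`. -/
def massForm {ρ : ℝ → ℝ} (hρ : MemLp ρ ⊤ volume) (k : ℝ) : sobolevTwo →L[ℝ] sobolevTwo →L[ℝ] ℝ :=
  k • (mulForm hρ).bilinearComp jet₀ jet₀ + (mulForm hρ).bilinearComp jet₁ jet₁

/-- The bilinear form of `E₁`, with `k` in place of `|ξ|²`. Integration by parts turns
`∫ 4k|ψ'|² + (kψ + ψ'')²` into the diagonal `∫ k²ψ² + 2k|ψ'|² + |ψ''|²`. -/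
def viscousForm (μ k : ℝ) : sobolevTwo →L[ℝ] sobolevTwo →L[ℝ] ℝ :=
  jetForm (μ * k ^ 2) (2 * μ * k) μ

/-- The bilinear form with weight `m` on functions, without derivatives. -/
def weightForm {m : ℝ → ℝ} (hm : MemLp m ⊤ volume) : sobolevTwo →L[ℝ] sobolevTwo →L[ℝ] ℝ :=
  (mulForm hm).bilinearComp jet₀ jet₀

variable {ρ m : ℝ → ℝ} (hρ : MemLp ρ ⊤ volume) (hm : MemLp m ⊤ volume)

theorem massForm_apply (k : ℝ) (x y : sobolevTwo) :
    massForm hρ k x y = k * mulForm hρ (jet₀ x) (jet₀ y) + mulForm hρ (jet₁ x) (jet₁ y) := rfl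

theorem weightForm_apply (x y : sobolevTwo) :
    weightForm hm x y = mulForm hm (jet₀ x) (jet₀ y) := rfl

theorem massForm_symm (k : ℝ) (x y : sobolevTwo) : massForm hρ k x y = massForm hρ k y x := by
  rw [massForm_apply, massForm_apply, mulForm_symm hρ (jet₀ x), mulForm_symm hρ (jet₁ x)]

theorem mul_norm_sq_le_massForm {c k : ℝ} (hc : 0 ≤ c) (hcρ : ∀ x, c ≤ ρ x) (hk : 0 ≤ k)
    (x : sobolevTwo) : k * c * ‖jet₀ x‖ ^ 2 ≤ massForm hρ k x x := by
  have h (f : L2) : c * ‖f‖ ^ 2 ≤ mulForm hρ f f := by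
    rw [← mulForm_const_self]
    exact mulForm_mono _ hρ hcρ f
  have h₁ : 0 ≤ c * ‖jet₁ x‖ ^ 2 := by positivity
  rw [massForm_apply]
  linarith [mul_le_mul_of_nonneg_left (h (jet₀ x)) hk, h (jet₁ x)]

theorem weightForm_le_massForm {c k C : ℝ} (hc : 0 < c) (hcρ : ∀ x, c ≤ ρ x) (hk : 0 < k)
    (hC : 0 ≤ C) (hmC : ∀ x, m x ≤ C) (x : sobolevTwo) :
    weightForm hm x x ≤ C / (k * c) * massForm hρ k x x :=
  calc weightForm hm x x ≤ C * ‖jet₀ x‖ ^ 2 := by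
        rw [← mulForm_const_self, weightForm_apply]
        exact mulForm_mono hm _ hmC _
    _ = C / (k * c) * (k * c * ‖jet₀ x‖ ^ 2) := by field_simp
    _ ≤ C / (k * c) * massForm hρ k x x :=
        mul_le_mul_of_nonneg_left (mul_norm_sq_le_massForm hρ hc.le hcρ hk.le x) (by positivity)

set_option maxSynthPendingDepth 3 in
/-- The bilinear form of `|ξ|² E₀`: magnetic coefficients `c` minus the weight `m = g|ξ|²ρ'` of
gravity. -/
def potentialForm (c : Fin 3 → ℝ) : sobolevTwo →L[ℝ] sobolevTwo →L[ℝ] ℝ :=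
  jetForm (c 0) (c 1) (c 2) - weightForm hm

theorem potentialForm_apply (c : Fin 3 → ℝ) (x y : sobolevTwo) :
    potentialForm hm c x y = jetForm (c 0) (c 1) (c 2) x y - weightForm hm x y := rfl

theorem potentialForm_symm (c : Fin 3 → ℝ) (x y : sobolevTwo) :
    potentialForm hm c x y = potentialForm hm c y x := by
  rw [potentialForm_apply, potentialForm_apply, jetForm_symm, weightForm_apply, weightForm_apply,
    mulForm_symm]

/-- The pencil `s² J + s E₁ + |ξ|² E₀` of the modified variational principle. -/
def energyPencil (μ k : ℝ) (c : Fin 3 → ℝ) (s : ℝ) : sobolevTwo →L[ℝ] sobolevTwo →L[ℝ] ℝ :=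
  pencil (massForm hρ k) (viscousForm μ k) (potentialForm hm c) s

theorem energyPencil_apply (μ k : ℝ) (c : Fin 3 → ℝ) (s : ℝ) (x y : sobolevTwo) :
    energyPencil hρ hm μ k c s x y =
      s ^ 2 * massForm hρ k x y + s * viscousForm μ k x y + potentialForm hm c x y := rfl

theorem exists_energyPencil_degenerate {c₀ μ k : ℝ} {c : Fin 3 → ℝ} (hc₀ : 0 < c₀)
    (hcρ : ∀ x, c₀ ≤ ρ x) (hμ : 0 < μ) (hk : 0 < k) (hm : IsTest m) (hc : 0 ≤ c)
    {u₀ : sobolevTwo} (hu₀ : potentialForm (hm.memLp ⊤) c u₀ u₀ < 0) :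
    ∃ s > 0, (∀ x, 0 ≤ energyPencil hρ (hm.memLp ⊤) μ k c s x x) ∧
      ∃ u, massForm hρ k u u = 1 ∧ ∀ y, energyPencil hρ (hm.memLp ⊤) μ k c s u y = 0 := by
  obtain ⟨C, hC⟩ := hm.continuous.bounded_above_of_compact_support hm.compact
  have hδ : 0 < min (μ * k ^ 2) (min (2 * μ * k) μ) := by positivity
  refine exists_critical_parameter (massForm_symm hρ k) (jetForm_symm _ _ _)
    (potentialForm_symm _ c) (fun x => ?_) hδ (fun x => ?_) (fun x => ?_)
    (weightForm_le_massForm hρ (hm.memLp ⊤) hc₀ hcρ hk ((norm_nonneg _).trans (hC 0))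
      fun x => (le_abs_self _).trans (hC x))
    (isCompactForm_mulForm hm) hu₀
  · exact le_trans (by positivity) (mul_norm_sq_le_massForm hρ hc₀.le hcρ hk.le x)
  · exact mul_norm_sq_le_jetForm hδ.le (min_le_left _ _)
      ((min_le_right _ _).trans (min_le_left _ _)) ((min_le_right _ _).trans (min_le_right _ _)) x
  · have := mul_norm_sq_le_jetForm le_rfl (hc 0) (hc 1) (hc 2) x
    rw [potentialForm_apply]
    change 0 ≤ jetForm (c 0) (c 1) (c 2) x x - weightForm _ x x + weightForm _ x x
    linarith

end Forms

section Energies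

variable {ρ ψ : ℝ → ℝ}

/-- The coefficients of `|ψ|²`, `|ψ'|²` and `|ψ''|²` in the magnetic part of `|ξ|² E₀`. -/
def magneticCoeff (M : ℝ) (ξ : Freq) : FieldDir → Fin 3 → ℝ
  | .horizontal => ![M ^ 2 * ξ 0 ^ 2 * ‖ξ‖ ^ 2, M ^ 2 * ξ 0 ^ 2, 0]
  | .vertical => ![0, M ^ 2 * ‖ξ‖ ^ 2, M ^ 2]

theorem magneticCoeff_nonneg (M : ℝ) (ξ : Freq) (dir : FieldDir) : 0 ≤ magneticCoeff M ξ dir := by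
  have h₀ : 0 ≤ M ^ 2 * ξ 0 ^ 2 := by positivity
  have h₁ : 0 ≤ M ^ 2 * ‖ξ‖ ^ 2 := by positivity
  intro i
  cases dir <;> fin_cases i
  exacts [mul_nonneg h₀ (sq_nonneg _), h₀, le_rfl, le_rfl, h₁, sq_nonneg M]

theorem integrable_sq_of_memH_two (hψ : MemH 2 ψ) :
    (Integrable fun x => ψ x ^ 2) ∧ (Integrable fun x => weakDeriv ψ x ^ 2) ∧
      Integrable fun x => weakDeriv (weakDeriv ψ) x ^ 2 := by
  obtain ⟨x, h⟩ := hψ.exists_jet₀_ae_eq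
  exact ⟨((memLp_congr_ae h).1 (Lp.memLp _)).integrable_sq,
    ((memLp_congr_ae (jet₁_ae_eq_weakDeriv h)).1 (Lp.memLp _)).integrable_sq,
    ((memLp_congr_ae (jet₂_ae_eq_weakDeriv h)).1 (Lp.memLp _)).integrable_sq⟩

theorem norm_sq_mul_E₀ (hρ : IsMultiplier ρ) (hψ : MemH 2 ψ) (g M : ℝ) {ξ : Freq} (hξ : ξ ≠ 0)
    (dir : FieldDir) :
    ‖ξ‖ ^ 2 * E₀ g M ρ ξ dir ψ = magneticCoeff M ξ dir 0 * (∫ x, ψ x ^ 2)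
      + magneticCoeff M ξ dir 1 * (∫ x, weakDeriv ψ x ^ 2)
      + magneticCoeff M ξ dir 2 * (∫ x, weakDeriv (weakDeriv ψ) x ^ 2)
      - ∫ x, g * ‖ξ‖ ^ 2 * deriv ρ x * ψ x ^ 2 := by
  have hnorm : ‖ξ‖ ≠ 0 := norm_ne_zero_iff.2 hξ
  obtain ⟨h₀, h₁, h₂⟩ := integrable_sq_of_memH_two hψ
  have hgrav : Integrable fun x => g * ‖ξ‖ ^ 2 * deriv ρ x * ψ x ^ 2 :=
    integrable_mul_sq ((hρ.isTest_deriv.memLp ⊤).const_mul _) hψ.1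
  simp only [← integral_const_mul]
  rw [← integral_add (h₀.const_mul _) (h₁.const_mul _),
    ← integral_add ((h₀.const_mul _).fun_add (h₁.const_mul _)) (h₂.const_mul _),
    ← integral_sub (((h₀.const_mul _).fun_add (h₁.const_mul _)).fun_add (h₂.const_mul _)) hgrav]
  cases dir <;> rw [E₀, ← integral_const_mul] <;> congr 1 with x <;>
    simp only [magneticCoeff, Matrix.cons_val] <;> field_simp <;> ring

variable {x : sobolevTwo}

theorem J_eq_massForm (hρ : MemLp ρ ⊤ volume) (h : jet₀ x =ᵐ[volume] ψ) (ξ : Freq) :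
    J ρ ξ ψ = massForm hρ (‖ξ‖ ^ 2) x x := by
  have h₁ := jet₁_ae_eq_weakDeriv h
  rw [massForm_apply, mulForm_eq_integral hρ h, mulForm_eq_integral hρ h₁, ← integral_const_mul,
    ← integral_add ((integrable_mul_sq hρ ((memLp_congr_ae h).1 (Lp.memLp _))).const_mul _)
      (integrable_mul_sq hρ ((memLp_congr_ae h₁).1 (Lp.memLp _))), J]
  simp only [mul_add, mul_left_comm]

theorem E₁_eq_viscousForm (h : jet₀ x =ᵐ[volume] ψ) (μ : ℝ) (ξ : Freq) :
    E₁ μ ξ ψ = viscousForm μ (‖ξ‖ ^ 2) x x := by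
  have hsum : ↑(‖ξ‖ ^ 2 • jet₀ x + jet₂ x)
      =ᵐ[volume] fun t => ‖ξ‖ ^ 2 * ψ t + weakDeriv (weakDeriv ψ) t := by
    filter_upwards [h, jet₂_ae_eq_weakDeriv h, Lp.coeFn_add (‖ξ‖ ^ 2 • jet₀ x) (jet₂ x),
      Lp.coeFn_smul (‖ξ‖ ^ 2) (jet₀ x)] with t h₀ h₂ hadd hsmul
    rw [hadd, Pi.add_apply, hsmul, Pi.smul_apply, smul_eq_mul, h₀, h₂]
  have h₁ := jet₁_ae_eq_weakDeriv h
  have hparts := inner_add_inner_eq_zero (isWeakDeriv_jet₀ x) (isWeakDeriv_jet₁ x)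
  rw [real_inner_self_eq_norm_sq] at hparts
  rw [E₁, integral_add (((memLp_congr_ae h₁).1 (Lp.memLp _)).integrable_sq.const_mul _)
    ((memLp_congr_ae hsum).1 (Lp.memLp _)).integrable_sq, integral_const_mul,
    ← norm_sq_eq_integral h₁, ← norm_sq_eq_integral hsum, norm_add_sq_real, norm_smul,
    real_inner_smul_left, Real.norm_of_nonneg (sq_nonneg _), viscousForm, jetForm_apply_self]
  linear_combination 2 * μ * ‖ξ‖ ^ 2 * hparts

theorem norm_sq_mul_E₀_eq_potentialForm (hρ : IsMultiplier ρ) (h : jet₀ x =ᵐ[volume] ψ) (g M : ℝ)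
    {ξ : Freq} (hξ : ξ ≠ 0) (dir : FieldDir) :
    ‖ξ‖ ^ 2 * E₀ g M ρ ξ dir ψ =
      potentialForm ((hρ.isTest_deriv.memLp ⊤).const_mul (g * ‖ξ‖ ^ 2))
        (magneticCoeff M ξ dir) x x := by
  rw [norm_sq_mul_E₀ hρ (memH_two_of_jet₀_ae_eq h) g M hξ, potentialForm_apply,
    jetForm_apply_self, weightForm_apply, mulForm_eq_integral _ h, norm_sq_eq_integral h,
    norm_sq_eq_integral (jet₁_ae_eq_weakDeriv h), norm_sq_eq_integral (jet₂_ae_eq_weakDeriv h)]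

theorem E_eq_energyPencil (hρ : IsMultiplier ρ) (h : jet₀ x =ᵐ[volume] ψ) (g μ M : ℝ) {ξ : Freq}
    (hξ : ξ ≠ 0) (dir : FieldDir) (s : ℝ) :
    E g μ M ρ dir ξ s ψ =
      energyPencil hρ.bounded ((hρ.isTest_deriv.memLp ⊤).const_mul (g * ‖ξ‖ ^ 2)) μ (‖ξ‖ ^ 2)
        (magneticCoeff M ξ dir) s x x - s ^ 2 * J ρ ξ ψ := by
  rw [E, norm_sq_mul_E₀_eq_potentialForm hρ h g M hξ, E₁_eq_viscousForm h,
    J_eq_massForm hρ.bounded h, energyPencil_apply]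
  ring

theorem isGrowthRate_of_energyPencil (hρ : IsMultiplier ρ) {g μ M : ℝ} {ξ : Freq} (hξ : ξ ≠ 0)
    {dir : FieldDir} {s : ℝ} (hs : 0 < s)
    (hnonneg : ∀ y, 0 ≤ energyPencil hρ.bounded
      ((hρ.isTest_deriv.memLp ⊤).const_mul (g * ‖ξ‖ ^ 2)) μ (‖ξ‖ ^ 2) (magneticCoeff M ξ dir) s y y)
    (hx : energyPencil hρ.bounded ((hρ.isTest_deriv.memLp ⊤).const_mul (g * ‖ξ‖ ^ 2)) μ (‖ξ‖ ^ 2)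
      (magneticCoeff M ξ dir) s x x = 0)
    (h : jet₀ x =ᵐ[volume] ψ) (hψ : ψ ∈ admissibleSet ρ ξ) : IsGrowthRate g μ M ρ dir ξ s := by
  refine ⟨hs, IsLeast.isGLB ⟨⟨ψ, hψ, ?_⟩, ?_⟩⟩
  · rw [E_eq_energyPencil hρ h g μ M hξ, hx, hψ.2]
    ring
  · rintro _ ⟨χ, hχ, rfl⟩
    obtain ⟨y, hy⟩ := hχ.1.exists_jet₀_ae_eq
    rw [E_eq_energyPencil hρ hy g μ M hξ, hχ.2]
    linarith [hnonneg y]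

end Energies

/-! ### Regularity of solutions of the Euler–Lagrange equation -/

section Beam

/-- The equation `α u'''' = (q u')' - r u` of a beam under tension, the shape of the Euler–Lagrange
equation of the energies. -/
def SolvesBeamEquation (α : ℝ) (q r u : ℝ → ℝ) : Prop :=
  ∀ x, α * deriv^[4] u x = deriv q x * deriv u x + q x * deriv^[2] u x - r x * u x

theorem exists_hasDerivAt_of_weak_beam {f₀ f₁ f₂ q r : ℝ → ℝ} {α : ℝ} (hα : α ≠ 0)
    (h₀ : IsWeakDeriv f₀ f₁) (h₁ : IsWeakDeriv f₁ f₂) (hq : ContDiff ℝ ∞ q) (hr : Continuous r)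
    (h : ∀ η, IsTest η → (∫ x, α * f₂ x * deriv (deriv η) x) + (∫ x, q x * f₁ x * deriv η x)
      + ∫ x, r x * f₀ x * η x = 0) :
    ∃ u u₁ u₂ u₃ : ℝ → ℝ, f₀ =ᵐ[volume] u ∧ f₁ =ᵐ[volume] u₁ ∧ f₂ =ᵐ[volume] u₂ ∧
      (∀ x, HasDerivAt u (u₁ x) x) ∧ (∀ x, HasDerivAt u₁ (u₂ x) x) ∧
      (∀ x, HasDerivAt u₂ (u₃ x) x) ∧
      ∀ x, HasDerivAt u₃ (α⁻¹ * (deriv q x * u₁ x + q x * u₂ x - r x * u x)) x := by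
  have hqc := hq.continuous
  obtain ⟨D, hD, hA⟩ := exists_isWeakDeriv_of_integral_eq_zero
    (h₁.2.1.continuous_mul continuous_const) (h₁.1.continuous_mul hqc) (h₀.1.continuous_mul hr) h
  obtain ⟨v, hv, hvc⟩ := h₁.exists_continuous
  obtain ⟨u, hu, hu'⟩ := h₀.exists_hasDerivAt hv hvc
  have huc : Continuous u := continuous_iff_continuousAt.2 fun x => (hu' x).continuousAt
  obtain ⟨d, hd, hd'⟩ := hD.exists_hasDerivAt (v := fun x => r x * u x)
    (hu.mono fun x hx => congrArg (r x * ·) hx) (hr.mul huc)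
  have hdc : Continuous d := continuous_iff_continuousAt.2 fun x => (hd' x).continuousAt
  obtain ⟨a, ha, ha'⟩ := hA.exists_hasDerivAt (v := fun x => q x * v x - d x)
    (by filter_upwards [hv, hd] with x hx hx'; rw [hx, hx']) ((hqc.mul hvc).sub hdc)
  have hac : Continuous a := continuous_iff_continuousAt.2 fun x => (ha' x).continuousAt
  have hf₂ : f₂ =ᵐ[volume] fun x => α⁻¹ * a x := by
    filter_upwards [ha] with x hx
    rw [← hx, inv_mul_cancel_left₀ hα]
  obtain ⟨v', hv', hv''⟩ := h₁.exists_hasDerivAt hf₂ (continuous_const.mul hac)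
  obtain rfl : v = v' := (Continuous.ae_eq_iff_eq volume hvc
    (continuous_iff_continuousAt.2 fun x => (hv'' x).continuousAt)).1 (hv.symm.trans hv')
  exact ⟨u, v, _, fun x => α⁻¹ * (q x * v x - d x), hu, hv, hf₂, hu', hv'',
    fun x => (ha' x).const_mul _, fun x => ((((hq.differentiable (by simp) x).hasDerivAt.mul
      (hv'' x)).sub (hd' x)).const_mul _)⟩

theorem contDiff_of_linear_system {u u₁ u₂ u₃ p₀ p₁ p₂ : ℝ → ℝ} (hu : ∀ x, HasDerivAt u (u₁ x) x)
    (hu₁ : ∀ x, HasDerivAt u₁ (u₂ x) x) (hu₂ : ∀ x, HasDerivAt u₂ (u₃ x) x)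
    (hu₃ : ∀ x, HasDerivAt u₃ (p₀ x * u x + p₁ x * u₁ x + p₂ x * u₂ x) x)
    (h₀ : ContDiff ℝ ∞ p₀) (h₁ : ContDiff ℝ ∞ p₁) (h₂ : ContDiff ℝ ∞ p₂) : ContDiff ℝ ∞ u := by
  have hsucc {f f' : ℝ → ℝ} {n : ℕ} (h : ∀ x, HasDerivAt f (f' x) x) (hf' : ContDiff ℝ n f') :
      ContDiff ℝ (n + 1 : ℕ) f := by
    push_cast
    refine contDiff_succ_iff_deriv.2 ⟨fun x => (h x).differentiableAt, by simp, ?_⟩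
    rwa [show deriv f = f' from funext fun x => (h x).deriv]
  suffices ∀ n : ℕ, ContDiff ℝ n u ∧ ContDiff ℝ n u₁ ∧ ContDiff ℝ n u₂ ∧ ContDiff ℝ n u₃ from
    contDiff_infty.2 fun n => (this n).1
  intro n
  induction n with
  | zero =>
    have hzero {f f' : ℝ → ℝ} (h : ∀ x, HasDerivAt f (f' x) x) : ContDiff ℝ (0 : ℕ) f :=
      contDiff_zero.2 (continuous_iff_continuousAt.2 fun x => (h x).continuousAt)
    exact ⟨hzero hu, hzero hu₁, hzero hu₂, hzero hu₃⟩
  | succ n ih =>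
    obtain ⟨i, i₁, i₂, i₃⟩ := ih
    exact ⟨hsucc hu i₁, hsucc hu₁ i₂, hsucc hu₂ i₃, hsucc hu₃
      ((((contDiff_infty.1 h₀ n).mul i).add ((contDiff_infty.1 h₁ n).mul i₁)).add
        ((contDiff_infty.1 h₂ n).mul i₂))⟩

theorem exists_solvesBeamEquation_of_weak {f₀ f₁ f₂ q r : ℝ → ℝ} {α : ℝ} (hα : α ≠ 0)
    (h₀ : IsWeakDeriv f₀ f₁) (h₁ : IsWeakDeriv f₁ f₂) (hq : ContDiff ℝ ∞ q) (hr : ContDiff ℝ ∞ r)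
    (h : ∀ η, IsTest η → (∫ x, α * f₂ x * deriv (deriv η) x) + (∫ x, q x * f₁ x * deriv η x)
      + ∫ x, r x * f₀ x * η x = 0) :
    ∃ u, ContDiff ℝ ∞ u ∧ SolvesBeamEquation α q r u ∧ f₀ =ᵐ[volume] u ∧ f₁ =ᵐ[volume] deriv u ∧
      f₂ =ᵐ[volume] deriv^[2] u := by
  obtain ⟨u, u₁, u₂, u₃, hf₀, hf₁, hf₂, hu, hu₁, hu₂, hu₃⟩ :=
    exists_hasDerivAt_of_weak_beam hα h₀ h₁ hq hr.continuous h
  have hsmooth : ContDiff ℝ ∞ u := contDiff_of_linear_system hu hu₁ hu₂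
    (p₀ := fun x => α⁻¹ * -r x) (p₁ := fun x => α⁻¹ * deriv q x) (p₂ := fun x => α⁻¹ * q x)
    (fun x => (hu₃ x).congr_deriv (by ring)) (contDiff_const.mul hr.neg)
    (contDiff_const.mul (contDiff_infty_iff_deriv.1 hq).2) (contDiff_const.mul hq)
  obtain rfl : deriv u = u₁ := funext fun x => (hu x).deriv
  obtain rfl : deriv^[2] u = u₂ := funext fun x => (hu₁ x).deriv
  obtain rfl : deriv^[3] u = u₃ := funext fun x => (hu₂ x).deriv
  refine ⟨u, hsmooth, fun x => ?_, hf₀, hf₁, hf₂⟩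
  rw [show deriv^[4] u x = _ from (hu₃ x).deriv, mul_inv_cancel_left₀ hα]

theorem sub_sub_eq_integral_one_sub_mul {f f' f'' : ℝ → ℝ} (hf : ∀ x, HasDerivAt f (f' x) x)
    (hf' : ∀ x, HasDerivAt f' (f'' x) x) (hf'' : Continuous f'') (x : ℝ) :
    f (x + 1) - f x - f' x = ∫ s in (0 : ℝ)..1, (1 - s) * f'' (x + s) := by
  have hderiv (s : ℝ) : HasDerivAt (fun s => f (x + s) + (1 - s) * f' (x + s))
      ((1 - s) * f'' (x + s)) s :=
    (((hf (x + s)).comp_const_add x s).add (((hasDerivAt_id s).const_sub 1).mul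
      ((hf' (x + s)).comp_const_add x s))).congr_deriv (by simp)
  rw [intervalIntegral.integral_eq_sub_of_hasDerivAt (fun s _ => hderiv s)
    ((by fun_prop : Continuous fun s => (1 - s) * f'' (x + s)).intervalIntegrable _ _)]
  simp only [sub_self, zero_mul, add_zero, sub_zero, one_mul]
  ring

theorem sq_integral_one_sub_mul_le {k : ℝ → ℝ} (hk : Continuous k) :
    (∫ s in (0 : ℝ)..1, (1 - s) * k s) ^ 2 ≤ ∫ s in (0 : ℝ)..1, k s ^ 2 := by
  set T := ∫ s in (0 : ℝ)..1, (1 - s) * k s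
  have hpointwise : ∀ s ∈ Set.Icc (0 : ℝ) 1, 2 * T * ((1 - s) * k s) ≤ T ^ 2 + k s ^ 2 := by
    rintro s ⟨hs₀, hs₁⟩
    have hsq : ((1 - s) * k s) ^ 2 ≤ k s ^ 2 := by
      rw [mul_pow]
      exact mul_le_of_le_one_left (sq_nonneg _) (pow_le_one₀ (by linarith) (by linarith))
    linarith [two_mul_le_add_sq T ((1 - s) * k s)]
  have h : 2 * T * T ≤ T ^ 2 + ∫ s in (0 : ℝ)..1, k s ^ 2 :=
    calc 2 * T * T = ∫ s in (0 : ℝ)..1, 2 * T * ((1 - s) * k s) := by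
          rw [intervalIntegral.integral_const_mul]
      _ ≤ ∫ s in (0 : ℝ)..1, (T ^ 2 + k s ^ 2) :=
          intervalIntegral.integral_mono_on zero_le_one
            (Continuous.intervalIntegrable (by fun_prop) 0 1)
            (Continuous.intervalIntegrable (by fun_prop) 0 1) hpointwise
      _ = T ^ 2 + ∫ s in (0 : ℝ)..1, k s ^ 2 := by
          rw [intervalIntegral.integral_add (by simp)
              (Continuous.intervalIntegrable (by fun_prop) 0 1),
            intervalIntegral.integral_const, sub_zero, one_smul]
  linarith

theorem integrable_integral_comp_add {f : ℝ → ℝ} (hf : Integrable f) :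
    Integrable fun x => ∫ s in (0 : ℝ)..1, f (x + s) := by
  have hprod : Integrable (fun p : ℝ × ℝ => f (p.1 + p.2))
      (volume.prod (volume.restrict (Set.Ioc (0 : ℝ) 1))) := by
    have hmeas : AEStronglyMeasurable (fun p : ℝ × ℝ => f (p.1 + p.2))
        (volume.prod (volume.restrict (Set.Ioc (0 : ℝ) 1))) := by
      simpa only [Function.comp_def, add_comm] using
        hf.aestronglyMeasurable.comp_quasiMeasurePreserving
          (quasiMeasurePreserving_add_swap volume (volume.restrict (Set.Ioc (0 : ℝ) 1)))
    rw [integrable_prod_iff' hmeas]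
    refine ⟨ae_of_all _ fun s => hf.comp_add_right s, ?_⟩
    simp only [integral_add_right_eq_self fun x => ‖f x‖]
    exact integrable_const _
  simp only [intervalIntegral.integral_of_le zero_le_one]
  exact hprod.integral_prod_left

theorem memLp_deriv_of_memLp_second_deriv {f f' f'' : ℝ → ℝ} (hf : ∀ x, HasDerivAt f (f' x) x)
    (hf' : ∀ x, HasDerivAt f' (f'' x) x) (hcont : Continuous f'') (h : MemLp f 2 volume)
    (h'' : MemLp f'' 2 volume) : MemLp f' 2 volume := by
  have hfc : Continuous f := continuous_iff_continuousAt.2 fun x => (hf x).continuousAt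
  have hf'c : Continuous f' := continuous_iff_continuousAt.2 fun x => (hf' x).continuousAt
  have hshift : MemLp (fun x => f (x + 1)) 2 volume :=
    h.comp_measurePreserving (measurePreserving_add_right volume 1)
  have hremainder : MemLp (fun x => f (x + 1) - f x - f' x) 2 volume := by
    have hc : Continuous fun x => f (x + 1) - f x - f' x := by fun_prop
    rw [memLp_two_iff_integrable_sq hc.aestronglyMeasurable]
    refine (integrable_integral_comp_add h''.integrable_sq).mono' (hc.pow 2).aestronglyMeasurable
      (ae_of_all _ fun x => ?_)
    rw [Real.norm_of_nonneg (sq_nonneg _), sub_sub_eq_integral_one_sub_mul hf hf' hcont]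
    exact sq_integral_one_sub_mul_le (hcont.comp (continuous_const.add continuous_id))
  have heq : f' = fun x => f (x + 1) - f x - (f (x + 1) - f x - f' x) := by
    funext x
    ring
  rw [heq]
  exact (hshift.sub h).sub hremainder

theorem SolvesBeamEquation.memHInfty_iterate_deriv {q r u : ℝ → ℝ} {α : ℝ}
    (h : SolvesBeamEquation α q r u) (hα : α ≠ 0) (hq : IsMultiplier q) (hr : IsMultiplier r)
    (hu : ContDiff ℝ ∞ u) (hu₀ : MemLp u 2 volume) (hu₁ : MemLp (deriv u) 2 volume)
    (hu₂ : MemLp (deriv^[2] u) 2 volume) : ∀ j < 4, MemHInfty (deriv^[j] u) := by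
  have hsmooth (j : ℕ) : ContDiff ℝ ∞ (deriv^[j] u) := hu.iterate_deriv j
  have hderiv (j : ℕ) (x : ℝ) : HasDerivAt (deriv^[j] u) (deriv^[j + 1] u x) x := by
    rw [Function.iterate_succ_apply']
    exact ((hsmooth j).differentiable (by simp) x).hasDerivAt
  have hu₄ : deriv^[4] u = fun x =>
      α⁻¹ * ((deriv q x * deriv u x + q x * deriv^[2] u x) + -1 * (r x * u x)) := by
    funext x
    rw [eq_inv_mul_iff_mul_eq₀ hα, h x]
    ring
  have hfourth {n : ℕ} (h₀ : MemH n u) (h₁ : MemH n (deriv u)) (h₂ : MemH n (deriv^[2] u)) :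
      MemH n (deriv^[4] u) := by
    rw [hu₄]
    exact (((hq.isTest_deriv.isMultiplier.memH_mul h₁).add (hq.memH_mul h₂)).add
      ((hr.memH_mul h₀).const_mul _)).const_mul _
  have hu₃ : MemLp (deriv^[3] u) 2 volume := memLp_deriv_of_memLp_second_deriv (hderiv 2)
    (hderiv 3) (hsmooth 4).continuous hu₂ (hfourth (n := 0) hu₀ hu₁ hu₂)
  have hL2 : ∀ j < 4, MemLp (deriv^[j] u) 2 volume := by
    intro j hj
    interval_cases j
    exacts [hu₀, hu₁, hu₂, hu₃]
  suffices ∀ n : ℕ, ∀ j < 4, MemH n (deriv^[j] u) from fun j hj n => this n j hj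
  intro n
  induction n with
  | zero => exact hL2
  | succ n ih =>
    have hnext : ∀ j < 4, MemH n (deriv^[j + 1] u) := by
      intro j hj
      interval_cases j
      exacts [ih 1 (by simp), ih 2 (by simp), ih 3 (by simp),
        hfourth (ih 0 (by simp)) (ih 1 (by simp)) (ih 2 (by simp))]
    exact fun j hj => ⟨hL2 j hj, _,
      isWeakDeriv_of_hasDerivAt (hderiv j) (hsmooth _).continuous, hnext j hj⟩

end Beam

section EulerLagrange

variable {ρ m : ℝ → ℝ}

theorem locallyIntegrable_mul_of_memLp_top (hm : MemLp m ⊤ volume) (f : L2) :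
    LocallyIntegrable fun x => m x * f x :=
  ((Lp.memLp f).mul' hm (r := 2)).locallyIntegrable one_le_two

theorem mulForm_toL2 (hm : MemLp m ⊤ volume) (f : L2) {η : ℝ → ℝ} (hη : IsTest η) :
    mulForm hm f hη.toL2 = ∫ x, m x * f x * η x := by
  rw [mulForm_apply]
  refine integral_congr_ae ?_
  filter_upwards [(hη.memLp 2).coeFn_toLp] with x hx
  rw [IsTest.toL2, hx]

/-- The Euler–Lagrange equation of the pencil `s² J + s E₁ + |ξ|² E₀`, with `k` in place of
`|ξ|²`, magnetic coefficients `c` and gravitational weight `m`. -/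
def SolvesEulerLagrange (ρ m : ℝ → ℝ) (μ k : ℝ) (c : Fin 3 → ℝ) (s : ℝ) (u : ℝ → ℝ) : Prop :=
  SolvesBeamEquation (s * μ + c 2) (fun x => 2 * s * μ * k + c 1 + s ^ 2 * ρ x)
    (fun x => s * μ * k ^ 2 + c 0 + (s ^ 2 * k * ρ x + -1 * m x)) u

theorem weak_beam_of_energyPencil_eq_zero (hρ : MemLp ρ ⊤ volume) (hm : MemLp m ⊤ volume)
    {μ k s : ℝ} {c : Fin 3 → ℝ} {u : sobolevTwo} (hu : ∀ y, energyPencil hρ hm μ k c s u y = 0)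
    {η : ℝ → ℝ} (hη : IsTest η) :
    (∫ x, (s * μ + c 2) * jet₂ u x * deriv (deriv η) x)
      + (∫ x, (2 * s * μ * k + c 1 + s ^ 2 * ρ x) * jet₁ u x * deriv η x)
      + ∫ x, (s * μ * k ^ 2 + c 0 + (s ^ 2 * k * ρ x + -1 * m x)) * jet₀ u x * η x = 0 := by
  have hint {ζ : ℝ → ℝ} (hζ : IsTest ζ) (f : L2) : Integrable fun x => f x * ζ x :=
    hζ.integrable_mul (L2.locallyIntegrable f)
  have hintm {p ζ : ℝ → ℝ} (hp : MemLp p ⊤ volume) (hζ : IsTest ζ) (f : L2) :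
      Integrable fun x => p x * f x * ζ x :=
    hζ.integrable_mul (locallyIntegrable_mul_of_memLp_top hp f)
  have h₁ : ∫ x, (2 * s * μ * k + c 1 + s ^ 2 * ρ x) * jet₁ u x * deriv η x =
      (2 * s * μ * k + c 1) * (∫ x, jet₁ u x * deriv η x)
        + s ^ 2 * ∫ x, ρ x * jet₁ u x * deriv η x := by
    rw [← integral_const_mul, ← integral_const_mul, ← integral_add
      ((hint hη.deriv _).const_mul _) ((hintm hρ hη.deriv _).const_mul _)]
    congr 1 with x
    ring
  have h₀ : ∫ x, (s * μ * k ^ 2 + c 0 + (s ^ 2 * k * ρ x + -1 * m x)) * jet₀ u x * η x =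
      (s * μ * k ^ 2 + c 0) * (∫ x, jet₀ u x * η x) + (s ^ 2 * k * (∫ x, ρ x * jet₀ u x * η x)
        + -1 * ∫ x, m x * jet₀ u x * η x) := by
    simp only [← integral_const_mul]
    rw [← integral_add ((hintm hρ hη _).const_mul _) ((hintm hm hη _).const_mul _),
      ← integral_add ((hint hη _).const_mul _)
        (((hintm hρ hη _).const_mul _).fun_add ((hintm hm hη _).const_mul _))]
    congr 1 with x
    ring
  obtain ⟨y, hy₀, hy₁, hy₂⟩ := hη.exists_sobolevTwo
  have h := hu y
  rw [energyPencil_apply, massForm_apply, viscousForm, jetForm_apply, potentialForm_apply,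
    jetForm_apply, weightForm_apply, hy₀, hy₁, hy₂] at h
  simp only [mulForm_toL2] at h
  simp only [IsTest.toL2, L2.inner_toLp] at h
  simp only [h₀, h₁, mul_assoc (s * μ + c 2), integral_const_mul]
  linear_combination h

theorem exists_solvesEulerLagrange (hρ : IsMultiplier ρ) (hm : IsMultiplier m) {μ k s : ℝ}
    {c : Fin 3 → ℝ} (hα : s * μ + c 2 ≠ 0) {x : sobolevTwo}
    (hx : ∀ y, energyPencil hρ.bounded hm.bounded μ k c s x y = 0) :
    ∃ u, ContDiff ℝ ∞ u ∧ SolvesEulerLagrange ρ m μ k c s u ∧ jet₀ x =ᵐ[volume] u ∧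
      ∀ j < 4, MemHInfty (deriv^[j] u) := by
  have hq : IsMultiplier fun x => 2 * s * μ * k + c 1 + s ^ 2 * ρ x :=
    (isMultiplier_const _).add (hρ.const_mul _)
  have hr : IsMultiplier fun x => s * μ * k ^ 2 + c 0 + (s ^ 2 * k * ρ x + -1 * m x) :=
    (isMultiplier_const _).add ((hρ.const_mul _).add (hm.const_mul _))
  obtain ⟨u, hu, hode, h₀, h₁, h₂⟩ := exists_solvesBeamEquation_of_weak hα (isWeakDeriv_jet₀ x)
    (isWeakDeriv_jet₁ x) hq.smooth hr.smooth
    fun η hη => weak_beam_of_energyPencil_eq_zero hρ.bounded hm.bounded hx hη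
  exact ⟨u, hu, hode, h₀, hode.memHInfty_iterate_deriv hα hq hr hu
    ((memLp_congr_ae h₀).1 (Lp.memLp _)) ((memLp_congr_ae h₁).1 (Lp.memLp _))
    ((memLp_congr_ae h₂).1 (Lp.memLp _))⟩

end EulerLagrange

/-! ### Recovering the normal mode from its vertical velocity -/

section NormalMode

theorem tendsto_zero_of_memLp_deriv {f : ℝ → ℝ} (hf : ContDiff ℝ 1 f) (h : MemLp f 2 volume)
    (h' : MemLp (deriv f) 2 volume) : Tendsto f atBot (𝓝 0) ∧ Tendsto f atTop (𝓝 0) := by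
  have hderiv (x : ℝ) : HasDerivAt (fun x => f x ^ 2) (2 * (f x * deriv f x)) x :=
    ((hf.differentiable (by simp) x).hasDerivAt.fun_pow 2).congr_deriv (by ring)
  have hint : Integrable fun x => f x ^ 2 := h.integrable_sq
  have hint' : Integrable fun x => 2 * (f x * deriv f x) := (h.integrable_mul h').const_mul 2
  have hsqrt {l : Filter ℝ} (hl : Tendsto (fun x => f x ^ 2) l (𝓝 0)) : Tendsto f l (𝓝 0) := by
    rw [tendsto_zero_iff_abs_tendsto_zero]
    simpa only [Function.comp_def, Real.sqrt_sq_eq_abs, Real.sqrt_zero] using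
      (Real.continuous_sqrt.tendsto 0).comp hl
  exact ⟨hsqrt (tendsto_zero_of_hasDerivAt_of_integrableOn_Iic (a := 0) (fun x _ => hderiv x)
      hint'.integrableOn hint.integrableOn),
    hsqrt (tendsto_zero_of_hasDerivAt_of_integrableOn_Ioi (a := 0) (fun x _ => hderiv x)
      hint'.integrableOn hint.integrableOn)⟩

/-- The horizontal velocity amplitude `-ξᵢ u' / |ξ|²` belonging to the vertical amplitude `u`:
the solution of the divergence equation parallel to `ξ`. -/
def horizontalVelocity (ξ : Freq) (i : Fin 2) (u : ℝ → ℝ) : ℝ → ℝ :=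
  fun x => -ξ i / ‖ξ‖ ^ 2 * deriv u x

/-- The pressure amplitude belonging to the vertical amplitude `u`, obtained by solving the
horizontal momentum equations for `π`; `b` is the coefficient of `|ψ''|²` in `|ξ|² E₀`. -/
def pressure (ρ : ℝ → ℝ) (μ b : ℝ) (ξ : Freq) (s : ℝ) (u : ℝ → ℝ) : ℝ → ℝ :=
  fun x => -s / ‖ξ‖ ^ 2 * (ρ x * deriv u x) +
    (-(μ + b / s) * deriv u x + (μ + b / s) / ‖ξ‖ ^ 2 * deriv^[3] u x)

variable {ρ u : ℝ → ℝ} {g μ M s : ℝ} {ξ : Freq} {dir : FieldDir}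

theorem contDiff_horizontalVelocity (hu : ContDiff ℝ ∞ u) (ξ : Freq) (i : Fin 2) :
    ContDiff ℝ ∞ (horizontalVelocity ξ i u) :=
  contDiff_const.mul (contDiff_infty_iff_deriv.1 hu).2

theorem contDiff_pressure (hρ : ContDiff ℝ ∞ ρ) (hu : ContDiff ℝ ∞ u) (μ b : ℝ) (ξ : Freq)
    (s : ℝ) : ContDiff ℝ ∞ (pressure ρ μ b ξ s u) :=
  (contDiff_const.mul (hρ.mul (hu.iterate_deriv 1))).add
    ((contDiff_const.mul (hu.iterate_deriv 1)).add (contDiff_const.mul (hu.iterate_deriv 3)))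

theorem memHInfty_pressure (hρ : IsMultiplier ρ) (hu : ∀ j < 4, MemHInfty (deriv^[j] u))
    (μ b : ℝ) (ξ : Freq) (s : ℝ) : MemHInfty (pressure ρ μ b ξ s u) := fun n =>
  ((hρ.memH_mul (hu 1 (by simp) n)).const_mul _).add
    (((hu 1 (by simp) n).const_mul _).add ((hu 3 (by simp) n).const_mul _))

theorem deriv_horizontalVelocity (ξ : Freq) (i : Fin 2) (u : ℝ → ℝ) :
    deriv (horizontalVelocity ξ i u) = horizontalVelocity ξ i (deriv u) :=
  funext fun _ => deriv_const_mul_field _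

theorem deriv_pressure (hρ : ContDiff ℝ ∞ ρ) (hu : ContDiff ℝ ∞ u) (μ b : ℝ) (ξ : Freq)
    (s x : ℝ) : deriv (pressure ρ μ b ξ s u) x =
      -s / ‖ξ‖ ^ 2 * (deriv ρ x * deriv u x + ρ x * deriv^[2] u x) +
        (-(μ + b / s) * deriv^[2] u x + (μ + b / s) / ‖ξ‖ ^ 2 * deriv^[4] u x) := by
  have hderiv (j : ℕ) : HasDerivAt (deriv^[j] u) (deriv^[j + 1] u x) x := by
    rw [Function.iterate_succ_apply']
    exact ((hu.iterate_deriv j).differentiable (by simp) x).hasDerivAt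
  exact ((((hρ.differentiable (by simp) x).hasDerivAt.mul (hderiv 1)).const_mul _).add
    (((hderiv 1).const_mul _).add ((hderiv 3).const_mul _))).deriv

theorem sum_mul_horizontalVelocity (hξ : ξ ≠ 0) (u : ℝ → ℝ) (x : ℝ) :
    ξ 0 * horizontalVelocity ξ 0 u x + ξ 1 * horizontalVelocity ξ 1 u x + deriv u x = 0 := by
  have hnorm : ‖ξ‖ ≠ 0 := norm_ne_zero_iff.2 hξ
  have hsum : ‖ξ‖ ^ 2 = ξ 0 ^ 2 + ξ 1 ^ 2 := by
    rw [EuclideanSpace.real_norm_sq_eq, Fin.sum_univ_two]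
  simp only [horizontalVelocity]
  field_simp
  rw [hsum]
  ring

theorem horizontal_momentum (hs : s ≠ 0) (hξ : ξ ≠ 0) (ρ u : ℝ → ℝ) (μ b : ℝ) (i : Fin 2)
    (x : ℝ) :
    s ^ 2 * ρ x * horizontalVelocity ξ i u x - s * ξ i * pressure ρ μ b ξ s u x
        + s * μ * (‖ξ‖ ^ 2 * horizontalVelocity ξ i u x
          - deriv (deriv (horizontalVelocity ξ i u)) x)
      = b * (deriv (deriv (horizontalVelocity ξ i u)) x + ξ i * deriv u x) := by
  have hnorm : ‖ξ‖ ≠ 0 := norm_ne_zero_iff.2 hξ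
  simp only [deriv_horizontalVelocity, horizontalVelocity, pressure, Function.iterate_succ_apply,
    Function.iterate_zero_apply]
  field_simp
  ring

theorem vertical_momentum (hs : s ≠ 0) (hξ : ξ ≠ 0) (hρ : ContDiff ℝ ∞ ρ) (hu : ContDiff ℝ ∞ u)
    (hode : SolvesEulerLagrange ρ (fun x => g * ‖ξ‖ ^ 2 * deriv ρ x) μ (‖ξ‖ ^ 2)
      (magneticCoeff M ξ dir) s u) (x : ℝ) :
    s ^ 2 * ρ x * u x + s * deriv (pressure ρ μ (magneticCoeff M ξ dir 2) ξ s u) x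
        + s * μ * (‖ξ‖ ^ 2 * u x - deriv (deriv u) x) - g * deriv ρ x * u x
      = M ^ 2 * B₃ ξ (horizontalVelocity ξ 0 u) u dir x := by
  have hnorm : ‖ξ‖ ≠ 0 := norm_ne_zero_iff.2 hξ
  have hq : deriv (fun y => 2 * s * μ * ‖ξ‖ ^ 2 + magneticCoeff M ξ dir 1 + s ^ 2 * ρ y) x =
      s ^ 2 * deriv ρ x := by
    rw [deriv_const_add, deriv_const_mul_field]
  have h := hode x
  rw [hq] at h
  rw [deriv_pressure hρ hu]
  cases dir <;> simp only [B₃, magneticCoeff, Matrix.cons_val, deriv_horizontalVelocity,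
    horizontalVelocity, Function.iterate_succ_apply, Function.iterate_zero_apply] at h ⊢ <;>
    field_simp <;> linear_combination h

theorem isNormalMode_of_solvesEulerLagrange (hs : s ≠ 0) (hξ : ξ ≠ 0) (hρ : ContDiff ℝ ∞ ρ)
    (hu : ContDiff ℝ ∞ u) (hode : SolvesEulerLagrange ρ (fun x => g * ‖ξ‖ ^ 2 * deriv ρ x) μ
      (‖ξ‖ ^ 2) (magneticCoeff M ξ dir) s u)
    (hL2 : ∀ j < 4, MemHInfty (deriv^[j] u)) :
    IsNormalMode g μ M ρ dir ξ s (horizontalVelocity ξ 0 u) (horizontalVelocity ξ 1 u) u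
      (pressure ρ μ (magneticCoeff M ξ dir 2) ξ s u) := by
  have hvanish {j : ℕ} (hj : j < 3) := tendsto_zero_of_memLp_deriv
    ((hu.iterate_deriv j).of_le (by exact_mod_cast le_top)) (hL2 j (by lia) 0)
    (by rw [← Function.iterate_succ_apply' deriv]; exact hL2 (j + 1) (by lia) 0)
  obtain ⟨hbot, htop⟩ := hvanish (j := 0) (by simp)
  obtain ⟨hbot', htop'⟩ := hvanish (j := 1) (by simp)
  have hlim {l : Filter ℝ} (h : Tendsto (deriv u) l (𝓝 0)) (i : Fin 2) :
      Tendsto (horizontalVelocity ξ i u) l (𝓝 0) := by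
    have := h.const_mul (-ξ i / ‖ξ‖ ^ 2)
    rwa [mul_zero] at this
  refine ⟨contDiff_horizontalVelocity hu ξ 0, contDiff_horizontalVelocity hu ξ 1, hu,
    contDiff_pressure hρ hu _ _ _ _, fun x => ?_, fun x => ?_,
    vertical_momentum hs hξ hρ hu hode, sum_mul_horizontalVelocity hξ u, hlim hbot' 0,
    hlim hbot' 1, hbot, hlim htop' 0, hlim htop' 1, htop⟩
  · rw [horizontal_momentum hs hξ]
    cases dir <;> simp only [magneticCoeff, Matrix.cons_val, B₁, zero_mul, mul_zero]
  · rw [horizontal_momentum hs hξ]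
    cases dir <;> simp only [magneticCoeff, Matrix.cons_val, B₂, horizontalVelocity] ; ring

end NormalMode

/-! ### The solvable domain -/

section SolvableDomain

variable {ρ m : ℝ → ℝ} {g M : ℝ} {ξ : Freq}

theorem exists_isTest_integral_mul_sq_pos (hm : Continuous m) {x₀ : ℝ} (hx₀ : 0 < m x₀) :
    ∃ η, IsTest η ∧ 0 < ∫ x, m x * η x ^ 2 := by
  obtain ⟨r, hr, hball⟩ := Metric.eventually_nhds_iff_ball.1
    (hm.continuousAt.eventually_const_lt hx₀)
  let η : ContDiffBump x₀ := ⟨r / 2, r, half_pos hr, half_lt_self hr⟩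
  have hη₀ : η x₀ = 1 := η.one_of_mem_closedBall (Metric.mem_closedBall_self (half_pos hr).le)
  have hcompact : HasCompactSupport fun x => m x * η x ^ 2 := by
    simp only [sq]
    exact η.hasCompactSupport.mul_left.mul_left
  refine ⟨η, ⟨η.contDiff, η.hasCompactSupport⟩,
    (hm.mul (η.continuous.pow 2)).integral_pos_of_hasCompactSupport_nonneg_nonzero hcompact
      (fun x => ?_) (x := x₀) ?_⟩
  · by_cases hx : x ∈ Metric.ball x₀ r
    · exact mul_nonneg (hball x hx).le (sq_nonneg _)
    · simp only [η.zero_of_le_dist (not_lt.1 hx), Pi.zero_apply, ne_eq, OfNat.ofNat_ne_zero,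
        not_false_eq_true, zero_pow, mul_zero, le_refl]
  · rw [hη₀, one_pow, mul_one]
    exact hx₀.ne'

theorem exists_memH_two_lt (hm : MemLp m ⊤ volume) {ψ : ℝ → ℝ} (hψ : MemH 1 ψ) {a b : ℝ}
    (h : a * (∫ x, ψ x ^ 2) + b * (∫ x, weakDeriv ψ x ^ 2) < ∫ x, m x * ψ x ^ 2) :
    ∃ χ, MemH 2 χ ∧
      a * (∫ x, χ x ^ 2) + b * (∫ x, weakDeriv χ x ^ 2) < ∫ x, m x * χ x ^ 2 := by
  have hsub {f : ℝ → ℝ} (hf : MemLp f 2 volume) :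
      ∫ x, (a - m x) * f x ^ 2 = a * (∫ x, f x ^ 2) - ∫ x, m x * f x ^ 2 := by
    simp only [sub_mul]
    rw [integral_sub (hf.integrable_sq.const_mul a) (integrable_mul_sq hm hf),
      integral_const_mul]
  obtain ⟨χ, hχ, hneg⟩ := exists_memH_two_of_memH_one (m := fun x => a - m x) (b := b)
    ((memLp_top_const a).sub hm) hψ (by rw [hsub hψ.1]; linarith)
  rw [hsub hχ.1] at hneg
  exact ⟨χ, hχ, by linarith⟩

theorem E₀_neg_iff (hρ : IsMultiplier ρ) {ψ : ℝ → ℝ} (hψ : MemH 2 ψ) (hξ : ξ ≠ 0)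
    (dir : FieldDir) :
    E₀ g M ρ ξ dir ψ < 0 ↔ magneticCoeff M ξ dir 0 * (∫ x, ψ x ^ 2)
      + magneticCoeff M ξ dir 1 * (∫ x, weakDeriv ψ x ^ 2)
      + magneticCoeff M ξ dir 2 * (∫ x, weakDeriv (weakDeriv ψ) x ^ 2)
      < ∫ x, g * ‖ξ‖ ^ 2 * deriv ρ x * ψ x ^ 2 := by
  have hk : 0 < ‖ξ‖ ^ 2 := pow_pos (norm_pos_iff.2 hξ) 2
  rw [← mul_lt_mul_iff_right₀ hk, mul_zero, norm_sq_mul_E₀ hρ hψ g M hξ dir, sub_neg]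

theorem exists_E₀_neg_of_perp (hρ : IsRTProfile ρ) (hg : 0 < g) (hξ : ξ 0 = 0) :
    ∃ ψ, MemH 2 ψ ∧ E₀ g M ρ ξ .horizontal ψ < 0 := by
  obtain ⟨x₀, hx₀⟩ := hρ.exists_deriv_pos
  obtain ⟨η, hη, hpos⟩ := exists_isTest_integral_mul_sq_pos
    hρ.isMultiplier.isTest_deriv.continuous hx₀
  obtain ⟨x, hx, -⟩ := hη.exists_sobolevTwo
  have hη₂ : MemH 2 η := memH_two_of_jet₀_ae_eq <| by
    rw [hx]
    exact (hη.memLp 2).coeFn_toLp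
  refine ⟨η, hη₂, ?_⟩
  have hE₀ : E₀ g M ρ ξ .horizontal η = -(g * ∫ x, deriv ρ x * η x ^ 2) := by
    rw [E₀, ← integral_const_mul, ← integral_neg]
    congr 1 with x
    rw [hξ]
    ring
  rw [hE₀]
  exact neg_neg_of_pos (mul_pos hg hpos)

theorem exists_lt_of_lt_real_sSup {S : Set ℝ} {a : ℝ} (ha : 0 ≤ a) (h : a < sSup S) :
    ∃ q ∈ S, a < q := by
  by_contra! hle
  exact h.not_ge (Real.sSup_le hle ha)

theorem exists_E₀_neg_of_lt_criticalFreqFun (hρ : IsMultiplier ρ) (hξ : ξ ≠ 0)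
    (hMξ : M * ξ 0 ≠ 0) (h : ‖ξ‖ < criticalFreqFun g M ρ ξ) :
    ∃ ψ, MemH 2 ψ ∧ E₀ g M ρ ξ .horizontal ψ < 0 := by
  have hk : 0 < ‖ξ‖ := norm_pos_iff.2 hξ
  rw [criticalFreqFun, Real.lt_sqrt hk.le] at h
  obtain ⟨_, ⟨ψ, hψ, -, rfl⟩, hlt⟩ := exists_lt_of_lt_real_sSup (sq_nonneg _) h
  have hpos : 0 < ∫ x, ψ x ^ 2 := (integral_nonneg fun x => sq_nonneg _).lt_of_ne' fun h0 => by
    rw [h0, div_zero] at hlt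
    exact (sq_nonneg _).not_gt hlt
  rw [lt_div_iff₀ hpos, lt_sub_iff_add_lt, lt_div_iff₀ (by positivity), mul_pow] at hlt
  obtain ⟨χ, hχ, hneg⟩ := exists_memH_two_lt (m := fun x => g * ‖ξ‖ ^ 2 * deriv ρ x)
    (a := M ^ 2 * ξ 0 ^ 2 * ‖ξ‖ ^ 2) (b := M ^ 2 * ξ 0 ^ 2)
    ((hρ.isTest_deriv.memLp ⊤).const_mul _) hψ (by
      simp only [mul_assoc (g * ‖ξ‖ ^ 2), integral_const_mul]
      linarith)
  refine ⟨χ, hχ, (E₀_neg_iff hρ hχ hξ _).2 ?_⟩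
  simpa only [magneticCoeff, Matrix.cons_val, zero_mul, add_zero] using hneg

theorem exists_verticalQuotient_denom_pos (hρ : IsMultiplier ρ)
    (h : ENNReal.ofReal |M| < criticalNumber g ρ) :
    ∃ ψ, MemH 2 ψ ∧ 0 < ∫ x, (g * deriv ρ x * ψ x ^ 2 - M ^ 2 * weakDeriv ψ x ^ 2) := by
  rw [criticalNumber, one_div, ENNReal.lt_rpow_inv_iff two_pos] at h
  simp only [lt_iSup_iff] at h
  obtain ⟨ψ, ⟨hψ, -⟩, hlt⟩ := h
  rw [ENNReal.ofReal_rpow_of_nonneg (abs_nonneg _) two_pos.le, Real.rpow_two, sq_abs,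
    ENNReal.ofReal_lt_ofReal_iff_of_nonneg (sq_nonneg _)] at hlt
  have hpos : 0 < ∫ x, weakDeriv ψ x ^ 2 :=
    (integral_nonneg fun x => sq_nonneg _).lt_of_ne' fun h0 => by
      rw [h0, div_zero] at hlt
      exact (sq_nonneg _).not_gt hlt
  have hm : MemLp (fun x => g * deriv ρ x) ⊤ volume := (hρ.isTest_deriv.memLp ⊤).const_mul g
  obtain ⟨χ, hχ, hneg⟩ := exists_memH_two_lt hm hψ (a := 0) (b := M ^ 2)
    (by rwa [zero_mul, zero_add, ← lt_div_iff₀ hpos])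
  obtain ⟨-, hint, -⟩ := integrable_sq_of_memH_two hχ
  refine ⟨χ, hχ, ?_⟩
  rw [integral_sub (integrable_mul_sq hm hχ.1) (hint.const_mul _), integral_const_mul, sub_pos]
  rwa [zero_mul, zero_add] at hneg

theorem exists_E₀_neg_of_criticalFreqConst_lt (hρ : IsMultiplier ρ)
    (hM : ENNReal.ofReal |M| < criticalNumber g ρ) (h : criticalFreqConst g M ρ < ‖ξ‖) :
    ∃ ψ, MemH 2 ψ ∧ E₀ g M ρ ξ .vertical ψ < 0 := by
  have hk : 0 < ‖ξ‖ := (Real.sqrt_nonneg _).trans_lt h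
  obtain ⟨χ, hχ, hχpos⟩ := exists_verticalQuotient_denom_pos hρ hM
  rw [criticalFreqConst, Real.sqrt_lt' hk] at h
  obtain ⟨_, ⟨ψ, hψ, hpos, rfl⟩, hlt⟩ :=
    exists_lt_of_csInf_lt (by exact ⟨_, χ, hχ, hχpos, rfl⟩) h
  obtain ⟨-, hint, -⟩ := integrable_sq_of_memH_two hψ
  refine ⟨ψ, hψ, (E₀_neg_iff hρ hψ (norm_pos_iff.1 hk) _).2 ?_⟩
  have hgrav : MemLp (fun x => g * deriv ρ x) ⊤ volume := (hρ.isTest_deriv.memLp ⊤).const_mul g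
  have hscale : ∫ x, g * ‖ξ‖ ^ 2 * deriv ρ x * ψ x ^ 2 =
      ‖ξ‖ ^ 2 * ∫ x, g * deriv ρ x * ψ x ^ 2 := by
    rw [← integral_const_mul]
    congr 1 with x
    ring
  rw [div_lt_iff₀ hpos, integral_sub (integrable_mul_sq hgrav hψ.1) (hint.const_mul _),
    integral_const_mul] at hlt
  simp only [magneticCoeff, Matrix.cons_val, hscale]
  linarith

theorem ne_zero_of_mem_solvableDomain {dir : FieldDir} (h : ξ ∈ solvableDomain g M ρ dir) :
    ξ ≠ 0 := by
  cases dir with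
  | horizontal => exact h.2
  | vertical => exact norm_pos_iff.1 ((Real.sqrt_nonneg _).trans_lt h)

theorem exists_E₀_neg_of_mem_solvableDomain (hg : 0 < g) (hρ : IsRTProfile ρ) {dir : FieldDir}
    (hM : AdmissibleField g ρ M dir) (h : ξ ∈ solvableDomain g M ρ dir) :
    ∃ ψ, MemH 2 ψ ∧ E₀ g M ρ ξ dir ψ < 0 := by
  have hξ := ne_zero_of_mem_solvableDomain h
  cases dir with
  | horizontal =>
    by_cases hξ₀ : ξ 0 = 0
    · exact exists_E₀_neg_of_perp hρ hg hξ₀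
    · exact exists_E₀_neg_of_lt_criticalFreqFun hρ.isMultiplier hξ (mul_ne_zero hM hξ₀)
        (h.1.resolve_right hξ₀).2.2
  | vertical => exact exists_E₀_neg_of_criticalFreqConst_lt hρ.isMultiplier hM.2 h

end SolvableDomain

end RTMHD

end

theorem theorem2p2_general (g μ M : ℝ) (hμ : 0 < μ) (ρ : ℝ → ℝ) (hρ : RTMHD.IsMultiplier ρ)
    (hinf : ∃ c : ℝ, 0 < c ∧ ∀ x, c ≤ ρ x) (dir : RTMHD.FieldDir) (ξ : RTMHD.Freq) (hξ : ξ ≠ 0)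
    (hE₀ : ∃ ψ, RTMHD.MemH 2 ψ ∧ RTMHD.E₀ g M ρ ξ dir ψ < 0) :
    ∃ lam : ℝ, 0 < lam ∧ RTMHD.IsGrowthRate g μ M ρ dir ξ lam ∧
      ∃ φ θ ψ p : ℝ → ℝ, RTMHD.IsNormalMode g μ M ρ dir ξ lam φ θ ψ p ∧
        RTMHD.MemHInfty φ ∧ RTMHD.MemHInfty θ ∧ RTMHD.MemHInfty ψ ∧ RTMHD.MemHInfty p ∧
        ψ ∈ RTMHD.admissibleSet ρ ξ := by
  have hk : 0 < ‖ξ‖ ^ 2 := pow_pos (norm_pos_iff.2 hξ) 2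
  have hc := RTMHD.magneticCoeff_nonneg M ξ dir
  have hm : RTMHD.IsTest fun x => g * ‖ξ‖ ^ 2 * deriv ρ x :=
    hρ.isTest_deriv.mul_left contDiff_const
  obtain ⟨c₀, hc₀, hcρ⟩ := hinf
  obtain ⟨ψ, hψ, hneg⟩ := hE₀
  obtain ⟨u₀, hu₀⟩ := hψ.exists_jet₀_ae_eq
  obtain ⟨s, hs, hnonneg, x, hJ, hx⟩ := RTMHD.exists_energyPencil_degenerate hρ.bounded hc₀ hcρ hμ
    hk hm hc ((RTMHD.norm_sq_mul_E₀_eq_potentialForm hρ hu₀ g M hξ dir).symm.trans_lt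
      (mul_neg_of_pos_of_neg hk hneg))
  obtain ⟨u, hu, hode, hxu, hreg⟩ := RTMHD.exists_solvesEulerLagrange hρ hm.isMultiplier
    (add_pos_of_pos_of_nonneg (mul_pos hs hμ) (hc 2)).ne' hx
  have hadm : u ∈ RTMHD.admissibleSet ρ ξ :=
    ⟨hreg 0 four_pos 2, (RTMHD.J_eq_massForm hρ.bounded hxu ξ).trans hJ⟩
  have hderiv : RTMHD.MemHInfty (deriv u) := hreg 1 (by simp)
  exact ⟨s, hs, RTMHD.isGrowthRate_of_energyPencil hρ hξ hs hnonneg (hx x) hxu hadm, _, _, u, _,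
    RTMHD.isNormalMode_of_solvesEulerLagrange hs.ne' hξ hρ.smooth hu hode hreg,
    fun n => (hderiv n).const_mul _, fun n => (hderiv n).const_mul _, hreg 0 four_pos,
    RTMHD.memHInfty_pressure hρ hreg _ _ _ _, hadm⟩

theorem theorem2p2 (g μ M : ℝ) (hg : 0 < g) (hμ : 0 < μ) (ρ : ℝ → ℝ)
    (hρ : RTMHD.IsRTProfile ρ) (dir : RTMHD.FieldDir) (hM : RTMHD.AdmissibleField g ρ M dir)
    (ξ : RTMHD.Freq) (hξ : ξ ∈ RTMHD.solvableDomain g M ρ dir) :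
    ∃ lam : ℝ, 0 < lam ∧ RTMHD.IsGrowthRate g μ M ρ dir ξ lam ∧
      ∃ φ θ ψ p : ℝ → ℝ, RTMHD.IsNormalMode g μ M ρ dir ξ lam φ θ ψ p ∧
        RTMHD.MemHInfty φ ∧ RTMHD.MemHInfty θ ∧ RTMHD.MemHInfty ψ ∧ RTMHD.MemHInfty p ∧
        ψ ∈ RTMHD.admissibleSet ρ ξ :=
  theorem2p2_general g μ M hμ ρ hρ.isMultiplier hρ.inf_pos dir ξ
    (RTMHD.ne_zero_of_mem_solvableDomain hξ)
    (RTMHD.exists_E₀_neg_of_mem_solvableDomain hg hρ hM hξ)
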